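/- Let $\Sigma=\{f\in L^2(\mathbf R;\mathbf C):\ f'\in L^2(\mathbf R),\ xf\in L^2(\mathbf R)\}$, with norm $\|f\|_\Sigma=\|f\|_{L^2}+\|f'\|_{L^2}+\|xf\|_{L^2}$. For every $R\ge 0$ there exists a constant $C$, depending only on $R$, such that the following holds for every $\varepsilon\in(0,1)$. Let $v_-,v^\varepsilon_-\in\Sigma$ satisfy $\|v_-\|_\Sigma\le R$ and $\|v^\varepsilon_-\|_\Sigma\le R$, and let $v,v^\varepsilon\in C([-\frac{\pi}{2},\frac{\pi}{2}];\Sigma)\cap C^1([-\frac{\pi}{2},\frac{\pi}{2}];\Sigma^*)$ be solutions, on $[-\frac{\pi}{2},\frac{\pi}{2}]\times\mathbf R$, to $$ i\partial_t v+\tfrac12\partial_x^2 v=\tfrac{x^2}{2}v+|v|^4v,\qquad v_{\mid t=-\pi/2}=v_-, $$ $$ i\partial_t v^\varepsilon+\tfrac12\partial_x^2 v^\varepsilon=\tfrac{x^2}{2}v^\varepsilon+(\cos t)^\varepsilon|v^\varepsilon|^{4+2\varepsilon}v^\varepsilon,\qquad v^\varepsilon_{\mid t=-\pi/2}=v^\varepsilon_-.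 $$ Then $$ \sup_{-\pi/2\le t\le \pi/2}\|v(t)-v^\varepsilon(t)\|_{L^2}\le C\|v_--v^\varepsilon_-\|_{L^2}+C\varepsilon. $$ In particular, for a fixed $v_-\in\Sigma$ and a family $(v_-^\varepsilon)_{0<\varepsilon<1}$ in $\Sigma$ with $\sup_{\varepsilon\in(0,1)}\|v_-^\varepsilon\|_\Sigma\le 2\|v_-\|_\Sigma$, the estimate holds with $C$ independent of $\varepsilon\in(0,1)$. -/

import Mathlib

open MeasureTheory Set Filter Topology
open scoped NNReal ENNReal ContDiff ComplexConjugate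

namespace HarmonicNLS

/-- `g` is the weak (distributional) derivative of `f` on the real line. -/
def HasWeakDeriv (f g : ℝ → ℂ) : Prop :=
  LocallyIntegrable f volume ∧ LocallyIntegrable g volume ∧
    ∀ φ : ℝ → ℝ, ContDiff ℝ ∞ φ → HasCompactSupport φ →
      ∫ x, ((deriv φ x : ℝ) : ℂ) * f x = -∫ x, ((φ x : ℝ) : ℂ) * g x

open Classical in
/-- The weak derivative of `f`, which is unique up to a null set; it is `0` if there is none. -/
noncomputable def weakDeriv (f : ℝ → ℂ) : ℝ → ℂ :=
  if h : ∃ g, HasWeakDeriv f g then h.choose else 0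

/-- `f` belongs to `Σ`: the functions `f`, `f'` and `x f` are all in `L²(ℝ)`. -/
def MemSigma (f : ℝ → ℂ) : Prop :=
  MemLp f 2 volume ∧ (∃ g, HasWeakDeriv f g ∧ MemLp g 2 volume) ∧
    MemLp (fun x : ℝ => (x : ℂ) * f x) 2 volume

/-- The norm `‖f‖_{L²} + ‖f'‖_{L²} + ‖x f‖_{L²}` of `Σ`, for `f` in `Σ`. -/
noncomputable def sigmaNorm (f : ℝ → ℂ) : ℝ≥0∞ :=
  eLpNorm f 2 volume + eLpNorm (weakDeriv f) 2 volume +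
    eLpNorm (fun x : ℝ => (x : ℂ) * f x) 2 volume

/-- The pairing `⟨-½ f'' + ½ x² f + a |f|^p f, φ⟩` of `Σ*` with `Σ`, where `⟨f, φ⟩ = ∫ f φ̄ dx`. -/
noncomputable def weakRHS (a p : ℝ) (f φ : ℝ → ℂ) : ℂ :=
  (1 / 2) * (∫ x, weakDeriv f x * conj (weakDeriv φ x)) +
    (1 / 2) * (∫ x : ℝ, (x : ℂ) ^ 2 * f x * conj (φ x)) +
    (a : ℂ) * ∫ x, ((‖f x‖ ^ p : ℝ) : ℂ) * f x * conj (φ x)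

/-- The time interval `[-π/2, π/2]`. -/
noncomputable def timeInterval : Set ℝ := Icc (-(Real.pi / 2)) (Real.pi / 2)

/-- `v` is a solution in `C([-π/2, π/2]; Σ) ∩ C¹([-π/2, π/2]; Σ*)` of
`i ∂ₜ v + ½ ∂ₓ² v = ½ x² v + a(t) |v|^p v` with `v = v₀` at `t = -π/2`.
The equation is tested against all `φ` in `Σ`. -/
structure IsSolution (a : ℝ → ℝ) (p : ℝ) (v₀ : ℝ → ℂ) (v : ℝ → ℝ → ℂ) : Prop where
  memSigma : ∀ t ∈ timeInterval, MemSigma (v t)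
  continuous : ∀ t ∈ timeInterval,
    Tendsto (fun s => sigmaNorm (fun x => v s x - v t x)) (𝓝[timeInterval] t) (𝓝 0)
  equation : ∀ t ∈ timeInterval, ∀ φ : ℝ → ℂ, MemSigma φ →
    HasDerivWithinAt (fun s => ∫ x, v s x * conj (φ x))
      (-Complex.I * weakRHS (a t) p (v t) φ) timeInterval t
  initial : v (-(Real.pi / 2)) =ᵐ[volume] v₀

end HarmonicNLS

/-! With T f = (f', x f), both equations read i u' = ½ T*T u + N, where N = a(t) |u|^p u, a = (cos
t)^ε and p = 4 + 2ε; the limit equation is the case ε = 0. All bounds are uniform in ε ∈ [0, 1].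

Mass is conserved because N is pointwise a real multiple of u. With P(u) = (p + 2)⁻¹ ∫ |u|^(p+2),
the energy ½‖Tu‖² + 2 a P(u) has derivative 2 a' P(u). Solutions are too rough to differentiate it
directly; `IsWeakSol.hasDerivAt_energy` passes to the limit in difference quotients, using ‖u(t+h) -
u(t)‖² = o(h) and the fact that P is convex with Lipschitz gradient on bounded functions.

The main point is a sup bound independent of ε, although a' is singular at ±π/2 and the energy may
grow before t = 0. Near -π/2 a bootstrap works (`IsCosSol.norm_w_lt`): while Tu is bounded, P(u)
oscillates little over a short time, and the monotonicity of a turns this into a bound for Tu. From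
there to t = 0 the quotient of the energy by (cos t)^ε does not increase, and after 0 the energy
itself does not increase. The embedding H¹ ⊂ L^∞ concludes (`IsCosSol.exists_uniform_bound`).

For two bounded solutions the principal parts cancel in the derivative of ‖v - v^ε‖². The
nonlinearity is Lipschitz there, and the mismatch of coefficients and exponents costs O(ε (1 - log
cos t)). The logarithm is integrable up to ±π/2, so Gronwall's inequality applies
(`IsCosSol.norm_sub_le`). -/

namespace HarmonicNLS

/-! ### Abstract weak Schrödinger equations and mass conservation -/

section Abstract

variable {H G : Type*} [NormedAddCommGroup H] [InnerProductSpace ℂ H]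
  [NormedAddCommGroup G] [InnerProductSpace ℂ G]

/-- An abstract Schrödinger equation `∂ₜ u = -i (½ T* T u + N)` in weak form. Here `V` is the graph
of `T`, the curve `w` is `T u`, and the equation is tested against all elements of `V`. -/
structure IsWeakSol (V : Submodule ℂ (H × G)) (I : Set ℝ) (u : ℝ → H) (w : ℝ → G) (N : ℝ → H) :
    Prop where
  mem : ∀ t ∈ I, (u t, w t) ∈ V
  contU : ContinuousOn u I
  contW : ContinuousOn w I
  contN : ContinuousOn N I
  eqn : ∀ t ∈ I, ∀ φ ∈ V, HasDerivWithinAt (fun s => inner ℂ φ.1 (u s))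
    (-Complex.I * ((1 / 2) * inner ℂ φ.2 (w t) + inner ℂ φ.1 (N t))) I t

variable {V : Submodule ℂ (H × G)} {a b : ℝ} {I : Set ℝ} {u u' : ℝ → H} {w w' : ℝ → G}
  {N N' : ℝ → H}

theorem IsWeakSol.mono {J : Set ℝ} (h : IsWeakSol V I u w N) (hJ : J ⊆ I) :
    IsWeakSol V J u w N :=
  ⟨fun t ht => h.mem t (hJ ht), h.contU.mono hJ, h.contW.mono hJ, h.contN.mono hJ,
    fun t ht φ hφ => (h.eqn t (hJ ht) φ hφ).mono hJ⟩

theorem IsWeakSol.sub (h : IsWeakSol V I u w N) (h' : IsWeakSol V I u' w' N') :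
    IsWeakSol V I (fun t => u t - u' t) (fun t => w t - w' t) (fun t => N t - N' t) where
  mem t ht := V.sub_mem (h.mem t ht) (h'.mem t ht)
  contU := h.contU.sub h'.contU
  contW := h.contW.sub h'.contW
  contN := h.contN.sub h'.contN
  eqn t ht φ hφ := by
    have := (h.eqn t ht φ hφ).sub (h'.eqn t ht φ hφ)
    refine (this.congr_deriv ?_).congr_of_eventuallyEq
      (Eventually.of_forall fun s => ?_) ?_ <;> simp only [inner_sub_right, Pi.sub_apply]
    ring

theorem IsWeakSol.shift (h : IsWeakSol V I u w N) (τ : ℝ) :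
    IsWeakSol V ((fun t => t + τ) ⁻¹' I) (fun t => u (t + τ)) (fun t => w (t + τ))
      (fun t => N (t + τ)) where
  mem t ht := h.mem _ ht
  contU := h.contU.comp (by fun_prop) fun _ ht => ht
  contW := h.contW.comp (by fun_prop) fun _ ht => ht
  contN := h.contN.comp (by fun_prop) fun _ ht => ht
  eqn t ht φ hφ := by
    have h1 := h.eqn (t + τ) ht φ hφ
    have h2 : HasDerivWithinAt (fun t : ℝ => t + τ) 1 ((fun t => t + τ) ⁻¹' I) t :=
      (hasDerivAt_id t).add_const τ |>.hasDerivWithinAt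
    exact (h1.scomp t h2 (fun _ hx => hx)).congr_deriv (one_smul _ _)

/-- Mean value inequality for `⟨φ, u(s)⟩ - s ℓ`. The error depends on `φ` only through its two
norms, so the test element may afterwards be chosen depending on `s` and `t`. -/
theorem IsWeakSol.norm_inner_sub_le (h : IsWeakSol V I u w N) {J : Set ℝ} (hJ : J ⊆ I)
    (hJc : Convex ℝ J) {s t : ℝ} (hs : s ∈ J) (ht : t ∈ J) {w₀ : G} {N₀ : H} {A B : ℝ}
    (hA : ∀ τ ∈ J, ‖w τ - w₀‖ ≤ A) (hB : ∀ τ ∈ J, ‖N τ - N₀‖ ≤ B)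
    {φ : H × G} (hφ : φ ∈ V) :
    ‖inner ℂ φ.1 (u s - u t) - ((s - t : ℝ) : ℂ) *
      (-Complex.I * ((1 / 2) * inner ℂ φ.2 w₀ + inner ℂ φ.1 N₀))‖ ≤
      (1 / 2 * ‖φ.2‖ * A + ‖φ.1‖ * B) * |s - t| := by
  set ℓ : ℂ := -Complex.I * ((1 / 2) * inner ℂ φ.2 w₀ + inner ℂ φ.1 N₀) with hℓ
  have hd : ∀ τ ∈ J, HasDerivWithinAt (fun s => inner ℂ φ.1 (u s) - (s : ℂ) * ℓ)
      (-Complex.I * ((1 / 2) * inner ℂ φ.2 (w τ - w₀) + inner ℂ φ.1 (N τ - N₀))) J τ := by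
    intro τ hτ
    have h1 := (h.eqn τ (hJ hτ) φ hφ).mono hJ
    have h2 : HasDerivWithinAt (fun s : ℝ => (s : ℂ) * ℓ) (1 * ℓ) J τ :=
      ((hasDerivAt_id τ).ofReal_comp.mul_const ℓ).hasDerivWithinAt
    refine (h1.sub h2).congr_deriv ?_
    rw [hℓ, inner_sub_right, inner_sub_right]; ring
  have hbd : ∀ τ ∈ J, ‖-Complex.I * ((1 / 2) * inner ℂ φ.2 (w τ - w₀) +
      inner ℂ φ.1 (N τ - N₀))‖ ≤ 1 / 2 * ‖φ.2‖ * A + ‖φ.1‖ * B := by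
    intro τ hτ
    rw [norm_mul, norm_neg, Complex.norm_I, one_mul]
    refine (norm_add_le _ _).trans (add_le_add ?_ ?_)
    · rw [norm_mul, mul_assoc]
      have : ‖(1 / 2 : ℂ)‖ = 1 / 2 := by norm_num
      rw [this]
      gcongr
      exact (norm_inner_le_norm _ _).trans (by gcongr; exact hA τ hτ)
    · exact (norm_inner_le_norm _ _).trans (by gcongr; exact hB τ hτ)
  have := hJc.norm_image_sub_le_of_norm_hasDerivWithin_le hd hbd ht hs
  rw [Real.norm_eq_abs] at this
  refine le_trans (le_of_eq ?_) this
  congr 1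
  rw [inner_sub_right]; push_cast; ring

/-- The increment of the solution is used as its own test element. Since `w` is continuous, this
makes the squared increment o(|s - t|), the gain that closes the energy law. -/
theorem IsWeakSol.norm_sub_sq_le (h : IsWeakSol V (Icc a b) u w N) {s t A B : ℝ}
    (hs : s ∈ Icc a b) (ht : t ∈ Icc a b)
    (hA : ∀ τ ∈ uIcc s t, ‖w τ‖ ≤ A) (hB : ∀ τ ∈ uIcc s t, ‖N τ‖ ≤ B) :
    ‖u s - u t‖ ^ 2 ≤ (1 / 2 * ‖w s - w t‖ * A + ‖u s - u t‖ * B) * |s - t| := by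
  have := h.norm_inner_sub_le (J := uIcc s t) (uIcc_subset_Icc hs ht) (convex_uIcc s t)
    left_mem_uIcc right_mem_uIcc (w₀ := 0) (N₀ := 0) (by simpa using hA) (by simpa using hB)
    (V.sub_mem (h.mem s hs) (h.mem t ht))
  simp only [inner_zero_right, mul_zero, add_zero, sub_zero, Prod.fst_sub, Prod.snd_sub] at this
  rw [inner_self_eq_norm_sq_to_K, norm_pow] at this
  simpa using this

/-- The test element `u' s` moves with `s`, but the first-order expansion of `u` is uniform over
test elements bounded in the graph norm, and its linear coefficient is continuous in the test
element. -/
theorem IsWeakSol.hasDerivWithinAt_inner_left (h : IsWeakSol V I u w N)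
    (h' : IsWeakSol V I u' w' N') (hI : Convex ℝ I) {t : ℝ} (ht : t ∈ I) :
    HasDerivWithinAt (fun s => inner ℂ (u' s) (u s - u t))
      (-Complex.I * ((1 / 2) * inner ℂ (w' t) (w t) + inner ℂ (u' t) (N t))) I t := by
  rw [hasDerivWithinAt_iff_isLittleO, Asymptotics.isLittleO_iff]
  intro c hc
  set K := 1 / 2 * (‖w' t‖ + 1) + (‖u' t‖ + 1) with hK
  have hKpos : 0 < K := by positivity
  have hη : 0 < c / 2 / K := by positivity
  have e1 : ∀ᶠ s in 𝓝[I] t, ‖w s - w t‖ < c / 2 / K := by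
    simpa [dist_eq_norm] using (Metric.tendsto_nhds.1 (h.contW t ht)) _ hη
  have e2 : ∀ᶠ s in 𝓝[I] t, ‖N s - N t‖ < c / 2 / K := by
    simpa [dist_eq_norm] using (Metric.tendsto_nhds.1 (h.contN t ht)) _ hη
  have e3 : ∀ᶠ s in 𝓝[I] t, ‖w' s‖ < ‖w' t‖ + 1 :=
    (h'.contW t ht).norm.eventually_lt_const (by linarith)
  have e4 : ∀ᶠ s in 𝓝[I] t, ‖u' s‖ < ‖u' t‖ + 1 :=
    (h'.contU t ht).norm.eventually_lt_const (by linarith)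
  have e5 : ∀ᶠ s in 𝓝[I] t, ‖(-Complex.I * ((1 / 2) * inner ℂ (w' s) (w t) + inner ℂ (u' s) (N t)))
      - (-Complex.I * ((1 / 2) * inner ℂ (w' t) (w t) + inner ℂ (u' t) (N t)))‖ < c / 2 := by
    have : ContinuousWithinAt (fun s => -Complex.I * ((1 / 2) * inner ℂ (w' s) (w t) +
        inner ℂ (u' s) (N t))) I t :=
      continuousWithinAt_const.mul ((continuousWithinAt_const.mul
        ((h'.contW t ht).inner continuousWithinAt_const)).add
        ((h'.contU t ht).inner continuousWithinAt_const))
    simpa [dist_eq_norm] using (Metric.tendsto_nhds.1 this) _ (half_pos hc)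
  -- The bounds on `w` and `N` are needed on a whole convex neighbourhood and not only at `s`,
  -- because the mean value inequality runs along the segment from `t` to `s`.
  obtain ⟨δ, hδ, hball⟩ := Metric.mem_nhdsWithin_iff.1 (e1.and e2)
  filter_upwards [e3, e4, e5, self_mem_nhdsWithin,
    mem_nhdsWithin_of_mem_nhds (Metric.ball_mem_nhds t hδ)] with s h3 h4 h5 hs hsb
  have hcv : Convex ℝ (Metric.ball t δ ∩ I) := (convex_ball t δ).inter hI
  have key := h.norm_inner_sub_le (J := Metric.ball t δ ∩ I) inter_subset_right hcv
    ⟨hsb, hs⟩ ⟨Metric.mem_ball_self hδ, ht⟩ (fun τ hτ => (hball hτ).1.le)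
    (fun τ hτ => (hball hτ).2.le) (h'.mem s hs)
  simp only at key
  have hfin : (1 / 2 * ‖w' s‖ * (c / 2 / K) + ‖u' s‖ * (c / 2 / K)) ≤ c / 2 := by
    calc _ = (1 / 2 * ‖w' s‖ + ‖u' s‖) * (c / 2 / K) := by ring
      _ ≤ K * (c / 2 / K) := by gcongr; rw [hK]; gcongr
      _ = c / 2 := by field_simp
  simp only [sub_self, inner_zero_right, sub_zero, Complex.real_smul]
  set ℓs := -Complex.I * ((1 / 2) * inner ℂ (w' s) (w t) + inner ℂ (u' s) (N t)) with hℓs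
  set ℓt := -Complex.I * ((1 / 2) * inner ℂ (w' t) (w t) + inner ℂ (u' t) (N t)) with hℓt
  calc ‖inner ℂ (u' s) (u s - u t) - ((s - t : ℝ) : ℂ) * ℓt‖
      = ‖(inner ℂ (u' s) (u s - u t) - ((s - t : ℝ) : ℂ) * ℓs) +
          ((s - t : ℝ) : ℂ) * (ℓs - ℓt)‖ := by congr 1; ring
    _ ≤ c / 2 * |s - t| + |s - t| * (c / 2) := by
        refine (norm_add_le _ _).trans (add_le_add (key.trans ?_) ?_)
        · gcongr
        · rw [norm_mul, Complex.norm_real, Real.norm_eq_abs]; gcongr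
    _ = c * ‖s - t‖ := by rw [Real.norm_eq_abs]; ring

/-- The principal parts cancel in the derivative of the inner product of two solutions. -/
theorem IsWeakSol.hasDerivWithinAt_inner (h : IsWeakSol V I u w N)
    (h' : IsWeakSol V I u' w' N') (hI : Convex ℝ I) {t : ℝ} (ht : t ∈ I) :
    HasDerivWithinAt (fun s => inner ℂ (u s) (u' s))
      (Complex.I * (inner ℂ (N t) (u' t) - inner ℂ (u t) (N' t))) I t := by
  have h1 := (h.hasDerivWithinAt_inner_left h' hI ht).star
  have h2 := h'.eqn t ht _ (h.mem t ht)
  refine ((h1.add h2).congr_deriv ?_).congr_of_eventuallyEq (Eventually.of_forall fun s => ?_) ?_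
  · simp only [RCLike.star_def, map_mul, map_neg, map_add, Complex.conj_I, inner_conj_symm, map_div₀,
      map_one, Complex.conj_ofNat]
    ring
  · simp
  · simp

theorem IsWeakSol.hasDerivWithinAt_norm_sq (h : IsWeakSol V I u w N) (hI : Convex ℝ I) {t : ℝ}
    (ht : t ∈ I) :
    HasDerivWithinAt (fun s => ‖u s‖ ^ 2) (2 * (inner ℂ (u t) (N t)).im) I t := by
  have h1 := h.hasDerivWithinAt_inner h hI ht
  have h2 := Complex.reCLM.hasFDerivAt.comp_hasDerivWithinAt t h1
  refine (h2.congr_deriv ?_).congr_of_eventuallyEq (Eventually.of_forall fun s => ?_) ?_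
  · have : (inner ℂ (N t) (u t) : ℂ).im = -(inner ℂ (u t) (N t) : ℂ).im := by
      rw [← inner_conj_symm, Complex.conj_im]
    simp [this]
    ring
  · simp [inner_self_eq_norm_sq_to_K, ← Complex.ofReal_pow]
  · simp [inner_self_eq_norm_sq_to_K, ← Complex.ofReal_pow]

theorem IsWeakSol.norm_eq_of_inner_im_eq_zero (h : IsWeakSol V (Icc a b) u w N)
    (h0 : ∀ t ∈ Icc a b, (inner ℂ (u t) (N t)).im = 0) {t : ℝ} (ht : t ∈ Icc a b) :
    ‖u t‖ = ‖u a‖ := by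
  have hd : ∀ s ∈ Icc a b, HasDerivWithinAt (fun s => ‖u s‖ ^ 2) 0 (Icc a b) s := fun s hs =>
    (h.hasDerivWithinAt_norm_sq (convex_Icc a b) hs).congr_deriv (by rw [h0 s hs, mul_zero])
  have := (convex_Icc a b).norm_image_sub_le_of_norm_hasDerivWithin_le hd (C := 0) (by simp)
    (left_mem_Icc.2 (ht.1.trans ht.2)) ht
  have h2 : ‖u t‖ ^ 2 = ‖u a‖ ^ 2 := by
    rw [zero_mul] at this
    exact sub_eq_zero.1 (norm_le_zero_iff.1 this)
  exact (sq_eq_sq₀ (norm_nonneg _) (norm_nonneg _)).1 h2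

end Abstract

/-! ### The energy law -/

section Energy

/-- Strict differentiability is what lets the base point of the difference quotient move as well;
this gives the local uniformity needed to differentiate a limit. -/
theorem _root_.HasStrictDerivAt.tendsto_slope_prod {f : ℝ → ℝ} {f' t : ℝ}
    (hf : HasStrictDerivAt f f' t) :
    Tendsto (fun q : ℝ × ℝ => q.1⁻¹ * (f (q.2 + q.1) - f q.2)) (𝓝[>] 0 ×ˢ 𝓝 t) (𝓝 f') := by
  have hm : Tendsto (fun q : ℝ × ℝ => (q.2 + q.1, q.2)) (𝓝[>] 0 ×ˢ 𝓝 t) (𝓝 (t, t)) := by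
    have h0 : Tendsto (fun q : ℝ × ℝ => (q.2 + q.1, q.2)) (𝓝 ((0 : ℝ), t)) (𝓝 (t + 0, t)) :=
      Continuous.tendsto (by fun_prop) _
    rw [add_zero] at h0
    refine h0.mono_left ?_
    rw [nhds_prod_eq]
    exact Filter.prod_mono nhdsWithin_le_nhds le_rfl
  have h1 := (hf.isLittleO.comp_tendsto hm).tendsto_div_nhds_zero
  have h2 := h1.add_const f'
  rw [zero_add] at h2
  refine h2.congr' ?_
  have hpos : ∀ᶠ q : ℝ × ℝ in 𝓝[>] 0 ×ˢ 𝓝 t, 0 < q.1 :=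
    (tendsto_fst (f := 𝓝[>] (0 : ℝ)) (g := 𝓝 t)).eventually self_mem_nhdsWithin
  filter_upwards [hpos] with q hq
  simp [ContinuousLinearMap.toSpanSingleton_apply]
  field_simp
  ring

theorem exists_primitive_of_continuousOn_Ioo {f : ℝ → ℝ} {a b : ℝ} (hf : ContinuousOn f (Ioo a b)) :
    ∃ F : ℝ → ℝ, ∀ x ∈ Ioo a b, HasDerivAt F (f x) x := by
  by_cases hab : a < b
  · refine ⟨fun x => ∫ τ in ((a + b) / 2)..x, f τ, fun x hx => ?_⟩
    have hc : (a + b) / 2 ∈ Ioo a b := ⟨by linarith, by linarith⟩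
    refine intervalIntegral.integral_hasDerivAt_right ?_ ?_ (hf.continuousAt (isOpen_Ioo.mem_nhds hx))
    · exact (hf.mono ((ordConnected_Ioo).uIcc_subset hc hx)).intervalIntegrable
    · exact hf.stronglyMeasurableAtFilter isOpen_Ioo x hx
  · exact ⟨0, fun x hx => absurd (hx.1.trans hx.2) hab⟩

variable {H G : Type*} [NormedAddCommGroup H] [InnerProductSpace ℂ H]
  [NormedAddCommGroup G] [InnerProductSpace ℂ G]

variable {V : Submodule ℂ (H × G)} {a b : ℝ} {I : Set ℝ} {u u' : ℝ → H} {w w' : ℝ → G}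
  {N N' : ℝ → H}

/-- The equation is autonomous in its principal part, so a time translate is again a solution and
the `w` terms cancel. -/
theorem IsWeakSol.hasDerivAt_inner_shift (h : IsWeakSol V (Icc a b) u w N) {y τ : ℝ}
    (hy : y ∈ Ioo a b) (hyτ : y + τ ∈ Ioo a b) :
    HasDerivAt (fun s => (inner ℂ (u s) (u (s + τ))).im)
      ((inner ℂ (N y) (u (y + τ))).re - (inner ℂ (u y) (N (y + τ))).re) y := by
  set J := Icc a b ∩ (fun t => t + τ) ⁻¹' Icc a b with hJ
  have hJc : Convex ℝ J := (convex_Icc a b).inter ((convex_Icc a b).translate_preimage_left τ)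
  have hJn : J ∈ 𝓝 y := by
    refine Filter.inter_mem (Icc_mem_nhds hy.1 hy.2) ?_
    have : ContinuousAt (fun t => t + τ) y := by fun_prop
    exact this (Icc_mem_nhds hyτ.1 hyτ.2)
  have h1 := ((h.mono (J := J) inter_subset_left).hasDerivWithinAt_inner
    ((h.shift τ).mono (J := J) inter_subset_right) hJc (mem_of_mem_nhds hJn)).hasDerivAt hJn
  refine (Complex.imCLM.hasFDerivAt.comp_hasDerivAt y h1).congr_deriv ?_
  simp

theorem IsWeakSol.hasDerivAt_inner_im (h : IsWeakSol V (Icc a b) u w N) {y : ℝ}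
    (hy : y ∈ Ioo a b) :
    HasDerivAt (fun s => (inner ℂ (u y) (u s)).im)
      (-(1 / 2 * ‖w y‖ ^ 2 + (inner ℂ (u y) (N y)).re)) y := by
  have h1 := (h.eqn y (Ioo_subset_Icc_self hy) _ (h.mem y (Ioo_subset_Icc_self hy))).hasDerivAt
    (Icc_mem_nhds hy.1 hy.2)
  refine (Complex.imCLM.hasFDerivAt.comp_hasDerivAt y h1).congr_deriv ?_
  simp [inner_self_eq_norm_sq_to_K, ← Complex.ofReal_pow]

/-- The energy law, with no regularity beyond that of a weak solution: the function
`h⁻¹ Im ⟨u(t), u(t + h)⟩`, whose time derivative does not contain `w`, is compared with the energy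
as `h → 0`. -/
theorem IsWeakSol.hasDerivAt_energy (h : IsWeakSol V (Icc a b) u w N) {p : ℝ} {A A' P : ℝ → ℝ}
    (hA : ∀ t ∈ Ioo a b, HasDerivAt A (A' t) t) (hA' : ContinuousOn A' (Ioo a b))
    (hP : ContinuousOn P (Icc a b))
    (hNu : ∀ t ∈ Icc a b, (inner ℂ (u t) (N t)).re = (p + 2) * A t * P t)
    {L : ℝ} (hgrad : ∀ s ∈ Icc a b, ∀ t ∈ Icc a b,
      |(inner ℂ (N t) (u s - u t)).re - A t * (P s - P t)| ≤ L * ‖u s - u t‖ ^ 2)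
    {t : ℝ} (ht : t ∈ Ioo a b) :
    HasDerivAt (fun t => 1 / 2 * ‖w t‖ ^ 2 + 2 * A t * P t) (2 * A' t * P t) t := by
  have hPo : ContinuousOn P (Ioo a b) := hP.mono Ioo_subset_Icc_self
  have hAo : ContinuousOn A (Ioo a b) := fun s hs => (hA s hs).continuousAt.continuousWithinAt
  obtain ⟨Φ, hΦ⟩ := exists_primitive_of_continuousOn_Ioo (hAo.mul hPo)
  have hNu' : ∀ t ∈ Icc a b, (inner ℂ (N t) (u t)).re = (p + 2) * A t * P t := by
    intro t ht
    rw [← hNu t ht, ← inner_conj_symm, Complex.conj_re]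
  set l : Filter (ℝ × ℝ) := 𝓝[>] (0 : ℝ) ×ˢ 𝓝 t with hl
  have hpos : ∀ᶠ q : ℝ × ℝ in l, 0 < q.1 :=
    (tendsto_fst (f := 𝓝[>] (0 : ℝ)) (g := 𝓝 t)).eventually self_mem_nhdsWithin
  have t2 : Tendsto (fun q : ℝ × ℝ => q.2) l (𝓝 t) := tendsto_snd
  have t1 : Tendsto (fun q : ℝ × ℝ => q.2 + q.1) l (𝓝 t) := by
    have : Tendsto (fun q : ℝ × ℝ => q.1) l (𝓝 0) :=
      (tendsto_fst (f := 𝓝[>] (0 : ℝ)) (g := 𝓝 t)).mono_right nhdsWithin_le_nhds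
    simpa using t2.add this
  have hnt : Ioo a b ∈ 𝓝 t := isOpen_Ioo.mem_nhds ht
  have m2 : ∀ᶠ q : ℝ × ℝ in l, q.2 ∈ Ioo a b := t2 hnt
  have m1 : ∀ᶠ q : ℝ × ℝ in l, q.2 + q.1 ∈ Ioo a b := t1 hnt
  have cP : ContinuousAt P t := hPo.continuousAt hnt
  have cA' : ContinuousAt A' t := hA'.continuousAt hnt
  have cu : ContinuousAt u t := (h.contU.mono Ioo_subset_Icc_self).continuousAt hnt
  have cw : ContinuousAt w t := (h.contW.mono Ioo_subset_Icc_self).continuousAt hnt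
  -- As `h → 0`, the first term tends to `½‖w‖² + (p + 2) A P`. Subtracting `p` times the difference
  -- quotient of a primitive of `A P` leaves `½‖w‖² + 2 A P`. It remains to see that the derivatives
  -- converge locally uniformly.
  refine hasDerivAt_of_tendstoUniformlyOnFilter (l := 𝓝[>] (0 : ℝ))
    (f := fun h y => h⁻¹ * (-(inner ℂ (u y) (u (y + h))).im - p * (Φ (y + h) - Φ y)))
    (f' := fun h y => h⁻¹ * (-((inner ℂ (N y) (u (y + h))).re - (inner ℂ (u y) (N (y + h))).re) -
      p * (A (y + h) * P (y + h) - A y * P y)))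
    (g' := fun t => 2 * A' t * P t) ?_ ?_ ?_
  · rw [tendstoUniformlyOnFilter_iff_tendsto]
    refine Tendsto.mono_right ?_ (nhds_le_uniformity (2 * A' t * P t))
    rw [nhds_prod_eq]
    refine Tendsto.prodMk ?_ ?_
    · exact ((tendsto_const_nhds.mul (cA'.tendsto.comp t2)).mul (cP.tendsto.comp t2))
    -- With indices 0 and 1 for the times `y` and `y + h`, the numerator equals `(A₁ - A₀)(P₀ + P₁)`
    -- plus two first-order Taylor remainders of the potential. The main part yields `2 A' P`.
    · have s1 := (hasStrictDerivAt_of_hasDerivAt_of_continuousAt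
        (Filter.mem_of_superset hnt fun y hy => hA y hy) cA').tendsto_slope_prod
      have s2 := s1.mul ((cP.tendsto.comp t2).add (cP.tendsto.comp t1))
      obtain ⟨Mw, hMw⟩ := isCompact_Icc.exists_bound_of_continuousOn h.contW
      obtain ⟨MN, hMN⟩ := isCompact_Icc.exists_bound_of_continuousOn h.contN
      -- By `hgrad` the remainders are quadratic in the increment of `u`, whose square is o(h).
      have s3 : Tendsto (fun q : ℝ × ℝ => q.1⁻¹ *
          (-((inner ℂ (N q.2) (u (q.2 + q.1) - u q.2)).re - A q.2 * (P (q.2 + q.1) - P q.2)) +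
          ((inner ℂ (N (q.2 + q.1)) (u q.2 - u (q.2 + q.1))).re -
            A (q.2 + q.1) * (P q.2 - P (q.2 + q.1))))) l (𝓝 0) := by
        have hb : Tendsto (fun q : ℝ × ℝ => 2 * |L| * (1 / 2 * ‖w (q.2 + q.1) - w q.2‖ * Mw +
            ‖u (q.2 + q.1) - u q.2‖ * MN)) l (𝓝 0) := by
          have a1 := ((cw.tendsto.comp t1).sub (cw.tendsto.comp t2)).norm
          have a2 := ((cu.tendsto.comp t1).sub (cu.tendsto.comp t2)).norm
          rw [sub_self, norm_zero] at a1 a2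
          have := (((a1.const_mul (1 / 2)).mul_const Mw).add (a2.mul_const MN)).const_mul (2 * |L|)
          simpa using this
        refine squeeze_zero_norm' ?_ hb
        filter_upwards [hpos, m1, m2] with q hq hq1 hq2
        have i1 := Ioo_subset_Icc_self hq1
        have i2 := Ioo_subset_Icc_self hq2
        have hsub := uIcc_subset_Icc i1 i2
        have b1 := hgrad _ i1 _ i2
        have b2 := hgrad _ i2 _ i1
        have b3 := h.norm_sub_sq_le i1 i2 (fun τ hτ => hMw τ (hsub hτ))
          (fun τ hτ => hMN τ (hsub hτ))
        rw [show q.2 + q.1 - q.2 = q.1 by ring, abs_of_pos hq] at b3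
        rw [norm_sub_rev (u q.2)] at b2
        rw [Real.norm_eq_abs, abs_mul, abs_of_pos (inv_pos.2 hq), inv_mul_le_iff₀ hq]
        have b4 : L * ‖u (q.2 + q.1) - u q.2‖ ^ 2 ≤ |L| * ((1 / 2 * ‖w (q.2 + q.1) - w q.2‖ * Mw +
            ‖u (q.2 + q.1) - u q.2‖ * MN) * q.1) := by
          refine (mul_le_mul_of_nonneg_right (le_abs_self L) (sq_nonneg _)).trans ?_
          gcongr
        refine (abs_add_le _ _).trans ?_
        rw [abs_neg]
        linarith
      have s4 := s2.add s3
      rw [add_zero, show A' t * (P t + P t) = 2 * A' t * P t by ring] at s4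
      refine s4.congr' ?_
      filter_upwards [m1, m2] with q hq1 hq2
      have c1 := hNu' _ (Ioo_subset_Icc_self hq2)
      have c2 := hNu' _ (Ioo_subset_Icc_self hq1)
      have c3 : (inner ℂ (u q.2) (N (q.2 + q.1))).re = (inner ℂ (N (q.2 + q.1)) (u q.2)).re := by
        rw [← inner_conj_symm, Complex.conj_re]
      simp only [inner_sub_right, Complex.sub_re, c1, c2, c3, Function.comp]
      ring
  · filter_upwards [m1, m2] with q hq1 hq2
    refine HasDerivAt.const_mul _ (((h.hasDerivAt_inner_shift hq2 hq1).neg).sub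
      (HasDerivAt.const_mul p ?_))
    exact ((hΦ _ hq1).comp_add_const q.2 q.1).sub (hΦ _ hq2)
  · filter_upwards [hnt] with y hy
    have d := ((h.hasDerivAt_inner_im hy).neg.sub ((hΦ y hy).const_mul p)).tendsto_slope_zero_right
    refine (Tendsto.congr (fun s => ?_) d).trans (le_of_eq ?_)
    · have : (inner ℂ (u y) (u y)).im = 0 := inner_self_im (𝕜 := ℂ) (u y)
      simp only [Pi.sub_apply, Pi.neg_apply, smul_eq_mul, this]
      ring
    · rw [hNu y (Ioo_subset_Icc_self hy)]
      congr 1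
      simp
      ring

end Energy

/-! ### Weak derivatives and the Sobolev embedding -/

section SobolevEmbedding

theorem norm_integral_smul_le_eLpNorm {k : ℝ → ℝ} {g : ℝ → ℂ} (hk : MemLp k 2 volume)
    (hg : MemLp g 2 volume) :
    ‖∫ x, k x • g x‖ ≤ (eLpNorm k 2 volume).toReal * (eLpNorm g 2 volume).toReal := by
  have h1 : eLpNorm (k • g) 1 volume ≤ eLpNorm k 2 volume * eLpNorm g 2 volume :=
    eLpNorm_smul_le_mul_eLpNorm hg.1 hk.1
  rw [← ENNReal.toReal_mul, ← toReal_enorm]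
  refine ENNReal.toReal_mono (ENNReal.mul_ne_top hk.eLpNorm_ne_top hg.eLpNorm_ne_top) ?_
  refine (enorm_integral_le_lintegral_enorm _).trans ?_
  rwa [eLpNorm_one_eq_lintegral_enorm] at h1

section WeakDeriv

variable {f f₁ f₂ g g₁ g₂ : ℝ → ℂ}

theorem integrable_mul_of_locallyIntegrable {φ : ℝ → ℝ} (hφ : Continuous φ)
    (hc : HasCompactSupport φ) (hf : LocallyIntegrable f volume) :
    Integrable (fun x => ((φ x : ℝ) : ℂ) * f x) := by
  simpa only [Complex.real_smul] using hf.integrable_smul_left_of_hasCompactSupport hφ hc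

theorem HasWeakDeriv.congr (h : HasWeakDeriv f₁ g₁) (hf : f₁ =ᵐ[volume] f₂)
    (hg : g₁ =ᵐ[volume] g₂) : HasWeakDeriv f₂ g₂ := by
  refine ⟨h.1.congr hf, h.2.1.congr hg, fun φ hφ hc => ?_⟩
  have e1 : ∫ x, ((deriv φ x : ℝ) : ℂ) * f₂ x = ∫ x, ((deriv φ x : ℝ) : ℂ) * f₁ x :=
    integral_congr_ae (hf.mono fun x hx => by simp only [hx])
  have e2 : ∫ x, ((φ x : ℝ) : ℂ) * g₂ x = ∫ x, ((φ x : ℝ) : ℂ) * g₁ x :=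
    integral_congr_ae (hg.mono fun x hx => by simp only [hx])
  rw [e1, e2, h.2.2 φ hφ hc]

theorem HasWeakDeriv.const_smul (h : HasWeakDeriv f g) (c : ℂ) :
    HasWeakDeriv (c • f) (c • g) := by
  refine ⟨h.1.smul c, h.2.1.smul c, fun φ hφ hc => ?_⟩
  have := h.2.2 φ hφ hc
  simp only [Pi.smul_apply, smul_eq_mul, mul_left_comm _ c]
  rw [integral_const_mul, integral_const_mul, this]
  ring

theorem HasWeakDeriv.add (h₁ : HasWeakDeriv f₁ g₁) (h₂ : HasWeakDeriv f₂ g₂) :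
    HasWeakDeriv (f₁ + f₂) (g₁ + g₂) := by
  refine ⟨h₁.1.add h₂.1, h₁.2.1.add h₂.2.1, fun φ hφ hc => ?_⟩
  have hd : Continuous (deriv φ) := hφ.continuous_deriv (by simp)
  simp only [Pi.add_apply, mul_add]
  rw [integral_add (integrable_mul_of_locallyIntegrable hd hc.deriv h₁.1)
      (integrable_mul_of_locallyIntegrable hd hc.deriv h₂.1),
    integral_add (integrable_mul_of_locallyIntegrable hφ.continuous hc h₁.2.1)
      (integrable_mul_of_locallyIntegrable hφ.continuous hc h₂.2.1),
    h₁.2.2 φ hφ hc, h₂.2.2 φ hφ hc]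
  ring

theorem HasWeakDeriv.sub (h₁ : HasWeakDeriv f₁ g₁) (h₂ : HasWeakDeriv f₂ g₂) :
    HasWeakDeriv (f₁ - f₂) (g₁ - g₂) := by
  have := h₁.add (h₂.const_smul (-1))
  simpa [sub_eq_add_neg] using this

theorem hasWeakDeriv_zero : HasWeakDeriv 0 0 :=
  ⟨locallyIntegrable_zero, locallyIntegrable_zero, by simp⟩

theorem HasWeakDeriv.ae_unique (h₁ : HasWeakDeriv f g₁) (h₂ : HasWeakDeriv f g₂) :
    g₁ =ᵐ[volume] g₂ := by
  refine ae_eq_of_integral_contDiff_smul_eq h₁.2.1 h₂.2.1 fun φ hφ hc => ?_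
  simp only [Complex.real_smul]
  have := (h₁.2.2 φ hφ hc).symm.trans (h₂.2.2 φ hφ hc)
  exact neg_injective this

theorem HasWeakDeriv.weakDeriv_ae_eq (h : HasWeakDeriv f g) : weakDeriv f =ᵐ[volume] g := by
  have hex : ∃ g, HasWeakDeriv f g := ⟨g, h⟩
  rw [weakDeriv, dif_pos hex]
  exact hex.choose_spec.ae_unique h

theorem MemSigma.hasWeakDeriv (h : MemSigma f) : HasWeakDeriv f (weakDeriv f) := by
  obtain ⟨g, hg, -⟩ := h.2.1
  exact hg.congr (ae_eq_refl f) hg.weakDeriv_ae_eq.symm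

theorem MemSigma.memLp_weakDeriv (h : MemSigma f) : MemLp (weakDeriv f) 2 volume := by
  obtain ⟨g, hg, hg2⟩ := h.2.1
  exact hg2.ae_eq hg.weakDeriv_ae_eq.symm

/-- The Sobolev embedding `H¹(ℝ) ⊂ L^∞(ℝ)`. -/
theorem exists_norm_le_of_hasWeakDeriv : ∃ K : ℝ, 0 ≤ K ∧ ∀ f g : ℝ → ℂ, HasWeakDeriv f g →
    MemLp f 2 volume → MemLp g 2 volume → ∀ᵐ x, ‖f x‖ ≤
      K * ((eLpNorm f 2 volume).toReal + (eLpNorm g 2 volume).toReal) := by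
  let χ : ContDiffBump (0 : ℝ) := ⟨1, 2, one_pos, one_lt_two⟩
  have hχc : HasCompactSupport χ := χ.hasCompactSupport
  have hχ : ContDiff ℝ ∞ χ := χ.contDiff
  have hχ' : Continuous (deriv χ) := hχ.continuous_deriv (by simp)
  have mχ : MemLp χ 2 volume := χ.continuous.memLp_of_hasCompactSupport hχc
  have mχ' : MemLp (deriv χ) 2 volume := hχ'.memLp_of_hasCompactSupport hχc.deriv
  set a := (eLpNorm χ 2 volume).toReal with ha
  set b := (eLpNorm (deriv χ) 2 volume).toReal with hb
  refine ⟨a + b, by positivity, fun f g hfg hf hg => ?_⟩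
  let φ : ℕ → ContDiffBump (0 : ℝ) := fun n =>
    ⟨1 / ((n : ℝ) + 1) / 2, 1 / ((n : ℝ) + 1), by positivity, half_lt_self (by positivity)⟩
  have hφ0 : Tendsto (fun n => (φ n).rOut) atTop (𝓝 0) := tendsto_one_div_add_atTop_nhds_zero_nat
  have hφK : ∀ᶠ n in atTop, (φ n).rOut ≤ 2 * (φ n).rIn :=
    Eventually.of_forall fun n => by simp only [φ]; linarith
  filter_upwards [ContDiffBump.ae_convolution_tendsto_right_of_locallyIntegrable hφ0 hφK hfg.1]
    with x₀ hx₀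
  refine le_of_tendsto hx₀.norm (Eventually.of_forall fun n => ?_)
  rw [convolution_lsmul_swap]
  -- The mollified value of `f` at `x₀` is `∫ ρ f`. Let `Ψ` be a primitive of `ρ`, cut off by a
  -- translate `χ₀` of a fixed bump: up to a term with `deriv χ`, `ρ` is the derivative of `Ψ χ₀`,
  -- and the weak derivative can be brought in. As `|Ψ| ≤ 1`, the bound involves only the L² norms
  -- of `χ` and `deriv χ`, which depend neither on `n` nor on `x₀`.
  set ρ : ℝ → ℝ := fun y => (φ n).normed volume (x₀ - y) with hρ
  have hρs : ContDiff ℝ ∞ ρ := (φ n).contDiff_normed.comp (contDiff_const.sub contDiff_id)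
  have hρi : Integrable ρ := ((φ n).integrable_normed).comp_sub_left x₀
  have hρ1 : ∫ y, ρ y = 1 := by
    rw [hρ, integral_sub_left_eq_self ((φ n).normed volume) volume x₀, (φ n).integral_normed]
  have hρ0 : ∀ y, 0 ≤ ρ y := fun y => (φ n).nonneg_normed _
  set Ψ : ℝ → ℝ := fun y => ∫ s in (0 : ℝ)..y, ρ s with hΨ
  have hΨd : ∀ y, HasDerivAt Ψ (ρ y) y := fun y =>
    intervalIntegral.integral_hasDerivAt_right (hρs.continuous.intervalIntegrable _ _)
      (hρs.continuous.stronglyMeasurableAtFilter _ _) hρs.continuous.continuousAt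
  have hΨs : ContDiff ℝ ∞ Ψ := by
    rw [contDiff_infty_iff_deriv]
    refine ⟨fun y => (hΨd y).differentiableAt, ?_⟩
    rwa [show deriv Ψ = ρ from funext fun y => (hΨd y).deriv]
  have hΨ1 : ∀ y, |Ψ y| ≤ 1 := by
    intro y
    rw [← Real.norm_eq_abs]
    refine intervalIntegral.norm_integral_le_integral_norm_uIoc.trans ?_
    rw [← hρ1]
    simp only [Real.norm_eq_abs, abs_of_nonneg (hρ0 _)]
    exact setIntegral_le_integral hρi (Eventually.of_forall hρ0)
  set χ₀ : ℝ → ℝ := fun y => χ (y - x₀) with hχ₀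
  have hχ₀s : ContDiff ℝ ∞ χ₀ := hχ.comp (contDiff_id.sub contDiff_const)
  have hχ₀c : HasCompactSupport χ₀ := by
    simpa [hχ₀, Function.comp_def, sub_eq_add_neg] using
      hχc.comp_homeomorph (Homeomorph.addRight (-x₀))
  have hχ₀d : ∀ y, HasDerivAt χ₀ (deriv χ (y - x₀)) y := fun y => by
    have := (hχ.differentiable (by simp)).differentiableAt (x := y - x₀) |>.hasDerivAt
    exact this.comp_sub_const y x₀
  have hθc : HasCompactSupport (fun y => Ψ y * χ₀ y) := hχ₀c.mul_left
  have key := hfg.2.2 (fun y => Ψ y * χ₀ y) (hΨs.mul hχ₀s) hθc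
  have hder : ∀ y, deriv (fun y => Ψ y * χ₀ y) y = ρ y + Ψ y * deriv χ (y - x₀) := by
    intro y
    refine ((hΨd y).mul (hχ₀d y)).deriv.trans ?_
    congr 1
    -- The support of `ρ` has radius at most 1 around `x₀`, where the cutoff is 1.
    by_cases hy : dist (x₀ - y) 0 < (φ n).rOut
    · have : χ₀ y = 1 := by
        refine χ.one_of_mem_closedBall ?_
        have h1 : (φ n).rOut ≤ 1 := by
          simp only [φ]
          rw [div_le_one (by positivity)]
          linarith [(n.cast_nonneg : (0 : ℝ) ≤ n)]
        rw [Metric.mem_closedBall, dist_zero_right, norm_sub_rev]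
        rw [dist_zero_right] at hy
        exact hy.le.trans h1
      rw [this, mul_one]
    · have : ρ y = 0 := by
        have h2 : x₀ - y ∉ Function.support ((φ n).normed volume) := by
          rw [(φ n).support_normed_eq]; exact hy
        exact Function.notMem_support.1 h2
      rw [this, zero_mul]
  simp only [hder] at key
  have mp : MeasurePreserving (fun y : ℝ => y - x₀) volume volume :=
    measurePreserving_sub_right volume x₀
  have m1 : MemLp (fun y => Ψ y * χ₀ y) 2 volume :=
    (hΨs.continuous.mul hχ₀s.continuous).memLp_of_hasCompactSupport hθc
  have hc2 : HasCompactSupport (fun y => Ψ y * deriv χ (y - x₀)) := by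
    have : HasCompactSupport (fun y => deriv χ (y - x₀)) := by
      simpa [Function.comp_def, sub_eq_add_neg] using
        hχc.deriv.comp_homeomorph (Homeomorph.addRight (-x₀))
    exact this.mul_left
  have cont2 : Continuous (fun y => Ψ y * deriv χ (y - x₀)) :=
    hΨs.continuous.mul (hχ'.comp (by fun_prop))
  have m2 : MemLp (fun y => Ψ y * deriv χ (y - x₀)) 2 volume := cont2.memLp_of_hasCompactSupport hc2
  have n1 : (eLpNorm (fun y => Ψ y * χ₀ y) 2 volume).toReal ≤ a := by
    refine ENNReal.toReal_mono mχ.eLpNorm_ne_top ?_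
    rw [← eLpNorm_comp_measurePreserving mχ.1 mp]
    refine eLpNorm_mono fun y => ?_
    rw [norm_mul]
    exact mul_le_of_le_one_left (norm_nonneg _) (hΨ1 y)
  have n2 : (eLpNorm (fun y => Ψ y * deriv χ (y - x₀)) 2 volume).toReal ≤ b := by
    refine ENNReal.toReal_mono mχ'.eLpNorm_ne_top ?_
    rw [← eLpNorm_comp_measurePreserving mχ'.1 mp]
    refine eLpNorm_mono fun y => ?_
    rw [norm_mul]
    exact mul_le_of_le_one_left (norm_nonneg _) (hΨ1 y)
  have hρc : HasCompactSupport ρ := by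
    have := ((φ n).hasCompactSupport_normed (μ := volume)).comp_homeomorph (Homeomorph.subLeft x₀)
    simpa [Function.comp_def] using this
  have e1 : ∫ y, ρ y • f y = -(∫ y, (Ψ y * χ₀ y) • g y) - ∫ y, (Ψ y * deriv χ (y - x₀)) • f y := by
    simp only [Complex.real_smul]
    have i1 := integrable_mul_of_locallyIntegrable hρs.continuous hρc hfg.1
    have i2 := integrable_mul_of_locallyIntegrable cont2 hc2 hfg.1
    rw [← key, ← integral_sub]
    · refine integral_congr_ae (Eventually.of_forall fun y => ?_)
      push_cast
      ring
    · refine (i1.add i2).congr (Eventually.of_forall fun y => ?_)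
      simp only [Pi.add_apply]
      push_cast
      ring
    · exact i2
  change ‖∫ y, ρ y • f y‖ ≤ _
  rw [e1]
  have r1 := norm_integral_smul_le_eLpNorm m1 hg
  have r2 := norm_integral_smul_le_eLpNorm m2 hf
  refine (norm_sub_le _ _).trans ?_
  rw [norm_neg]
  have p1 : 0 ≤ (eLpNorm f 2 volume).toReal := ENNReal.toReal_nonneg
  have p2 : 0 ≤ (eLpNorm g 2 volume).toReal := ENNReal.toReal_nonneg
  have p3 : 0 ≤ a := ENNReal.toReal_nonneg
  have p4 : 0 ≤ b := ENNReal.toReal_nonneg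
  nlinarith [mul_le_mul_of_nonneg_right n1 p2, mul_le_mul_of_nonneg_right n2 p1,
    mul_nonneg p3 p1, mul_nonneg p4 p2]

end WeakDeriv

end SobolevEmbedding

/-! ### The power nonlinearity and its potential on L² -/

section Nonlinearity

/-- Convexity of the power, in the form of Bernoulli's inequality for `s / r - 1`; at `r = 0` the
left side vanishes. -/
theorem rpow_tangent_le {q r s : ℝ} (hq : 1 < q) (hr : 0 ≤ r) (hs : 0 ≤ s) :
    q * r ^ (q - 1) * (s - r) ≤ s ^ q - r ^ q := by
  rcases hr.eq_or_lt with rfl | hr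
  · rw [Real.zero_rpow (by linarith), Real.zero_rpow (by linarith)]
    simpa using Real.rpow_nonneg hs q
  · have h := one_add_mul_self_le_rpow_one_add (s := s / r - 1)
      (by have := div_nonneg hs hr.le; linarith) hq.le
    rw [show 1 + (s / r - 1) = s / r by ring, Real.div_rpow hs hr.le,
      le_div_iff₀ (Real.rpow_pos_of_pos hr q)] at h
    have hrq : r ^ q = r ^ (q - 1) * r := by
      rw [← Real.rpow_add_one hr.ne']; ring_nf
    have h2 : (1 + q * (s / r - 1)) * r ^ q = r ^ q + q * r ^ (q - 1) * (s - r) := by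
      rw [hrq]; field_simp
    linarith

/-- The nonlinearity `|z|^p z`. -/
noncomputable def nonlin (p : ℝ) (z : ℂ) : ℂ := ((‖z‖ ^ p : ℝ) : ℂ) * z

variable {p : ℝ}

theorem continuous_nonlin (hp : 0 ≤ p) : Continuous (nonlin p) :=
  (Complex.continuous_ofReal.comp (continuous_norm.rpow_const fun _ => Or.inr hp)).mul continuous_id

theorem norm_nonlin (z : ℂ) : ‖nonlin p z‖ = ‖z‖ ^ p * ‖z‖ := by
  rw [nonlin, norm_mul, Complex.norm_real, Real.norm_of_nonneg (by positivity)]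

/-- With `‖z₂‖ ≤ ‖z₁‖`, split off `‖z₁‖^p (z₁ - z₂)`. The tangent inequality at `‖z₁‖` controls the
difference of the powers, and the factor `‖z₂‖` restores the exponent `p`. -/
theorem norm_nonlin_sub_le (hp : 1 < p) {K : ℝ} {z₁ z₂ : ℂ} (h₁ : ‖z₁‖ ≤ K) (h₂ : ‖z₂‖ ≤ K) :
    ‖nonlin p z₁ - nonlin p z₂‖ ≤ (p + 1) * K ^ p * ‖z₁ - z₂‖ := by
  wlog h : ‖z₂‖ ≤ ‖z₁‖ generalizing z₁ z₂
  · rw [norm_sub_rev, norm_sub_rev z₁]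
    exact this h₂ h₁ (le_of_not_ge h)
  have hK : 0 ≤ K := (norm_nonneg _).trans h₁
  have e : nonlin p z₁ - nonlin p z₂ = ((‖z₁‖ ^ p : ℝ) : ℂ) * (z₁ - z₂) +
      ((‖z₁‖ ^ p - ‖z₂‖ ^ p : ℝ) : ℂ) * z₂ := by
    simp only [nonlin]; push_cast; ring
  have hmono : ‖z₂‖ ^ p ≤ ‖z₁‖ ^ p := Real.rpow_le_rpow (norm_nonneg _) h (by linarith)
  have hKp : ‖z₁‖ ^ p ≤ K ^ p := Real.rpow_le_rpow (norm_nonneg _) h₁ (by linarith)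
  have ht := rpow_tangent_le hp (norm_nonneg z₁) (norm_nonneg z₂)
  have hd : ‖z₁‖ - ‖z₂‖ ≤ ‖z₁ - z₂‖ := norm_sub_norm_le _ _
  have hr : ‖z₁‖ ^ (p - 1) * ‖z₂‖ ≤ K ^ p := by
    rcases eq_or_ne z₁ 0 with rfl | hz
    · have : z₂ = 0 := by simpa using h
      simp [this]; positivity
    · refine le_trans (mul_le_mul_of_nonneg_left h (by positivity)) ?_
      rw [← Real.rpow_add_one (norm_ne_zero_iff.2 hz), sub_add_cancel]
      exact hKp
  have hA : (‖z₁‖ ^ p - ‖z₂‖ ^ p) * ‖z₂‖ ≤ p * K ^ p * ‖z₁ - z₂‖ := by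
    calc (‖z₁‖ ^ p - ‖z₂‖ ^ p) * ‖z₂‖
        ≤ (p * ‖z₁‖ ^ (p - 1) * (‖z₁‖ - ‖z₂‖)) * ‖z₂‖ := by gcongr; linarith
      _ = p * (‖z₁‖ ^ (p - 1) * ‖z₂‖) * (‖z₁‖ - ‖z₂‖) := by ring
      _ ≤ p * K ^ p * ‖z₁ - z₂‖ := by
          have : 0 ≤ ‖z₁‖ - ‖z₂‖ := by linarith
          gcongr
  rw [e]
  refine (norm_add_le _ _).trans ?_
  rw [norm_mul, norm_mul, Complex.norm_real, Complex.norm_real, Real.norm_of_nonneg (by positivity),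
    Real.norm_of_nonneg (by linarith)]
  nlinarith [mul_le_mul_of_nonneg_right hKp (norm_nonneg (z₁ - z₂))]

theorem inner_nonlin_self (hp : 0 ≤ p) (z : ℂ) :
    inner ℂ z (nonlin p z) = ((‖z‖ ^ (p + 2) : ℝ) : ℂ) := by
  rw [RCLike.inner_apply, nonlin, mul_assoc, RCLike.mul_conj]
  rw [Real.rpow_add' (norm_nonneg z) (by linarith)]
  simp

/-- Convexity of `|z|^(p+2)`, whose gradient is `(p + 2) |z|^p z`: the radial tangent inequality
combined with Cauchy–Schwarz. -/
theorem re_inner_nonlin_le (hp : 0 ≤ p) (z₁ z₂ : ℂ) :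
    (p + 2) * (inner ℂ (nonlin p z₁) (z₂ - z₁)).re ≤ ‖z₂‖ ^ (p + 2) - ‖z₁‖ ^ (p + 2) := by
  have h := rpow_tangent_le (q := p + 2) (by linarith) (norm_nonneg z₁) (norm_nonneg z₂)
  have h1 : (inner ℂ (nonlin p z₁) z₂).re ≤ ‖z₁‖ ^ (p + 1) * ‖z₂‖ := by
    refine (Complex.re_le_norm _).trans ((norm_inner_le_norm _ _).trans (le_of_eq ?_))
    rw [norm_nonlin, Real.rpow_add_one' (norm_nonneg _) (by linarith)]
  have h2 : (inner ℂ (nonlin p z₁) z₁).re = ‖z₁‖ ^ (p + 1) * ‖z₁‖ := by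
    rw [← inner_conj_symm, Complex.conj_re, inner_nonlin_self hp, Complex.ofReal_re,
      ← Real.rpow_add_one' (norm_nonneg _) (by linarith)]
    ring_nf
  rw [inner_sub_right, Complex.sub_re, h2]
  refine le_trans ?_ h
  rw [show p + 2 - 1 = p + 1 by ring, mul_assoc]
  exact mul_le_mul_of_nonneg_left (by linarith) (by linarith)

/-- The space `L²(ℝ; ℂ)`. -/
noncomputable abbrev L2 := Lp ℂ 2 (volume : Measure ℝ)

open Classical in
/-- The class of `f` in `L²(ℝ; ℂ)`; it is `0` if `f` is not square-integrable. -/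
noncomputable def toL2 (f : ℝ → ℂ) : L2 := if h : MemLp f 2 volume then h.toLp f else 0

section toL2

variable {f g : ℝ → ℂ}

theorem coeFn_toL2 (h : MemLp f 2 volume) : toL2 f =ᵐ[volume] f := by
  rw [toL2, dif_pos h]; exact h.coeFn_toLp

theorem enorm_toL2 (h : MemLp f 2 volume) : ‖toL2 f‖ₑ = eLpNorm f 2 volume := by
  rw [toL2, dif_pos h, Lp.enorm_toLp]

theorem norm_toL2 (h : MemLp f 2 volume) : ‖toL2 f‖ = (eLpNorm f 2 volume).toReal := by
  rw [← enorm_toL2 h, toReal_enorm]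

theorem toL2_sub (hf : MemLp f 2 volume) (hg : MemLp g 2 volume) :
    toL2 (fun x => f x - g x) = toL2 f - toL2 g := by
  have h : MemLp (fun x => f x - g x) 2 volume := hf.sub hg
  refine Lp.ext ?_
  filter_upwards [coeFn_toL2 h, coeFn_toL2 hf, coeFn_toL2 hg, Lp.coeFn_sub (toL2 f) (toL2 g)]
    with x h1 h2 h3 h4
  rw [h1, h4, Pi.sub_apply, h2, h3]

theorem toL2_congr (hf : MemLp f 2 volume) (h : f =ᵐ[volume] g) : toL2 f = toL2 g := by
  refine Lp.ext ?_
  filter_upwards [coeFn_toL2 hf, coeFn_toL2 (hf.ae_eq h), h] with x h1 h2 h3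
  rw [h1, h2, h3]

end toL2

/-- The nonlinearity as a map on `L²`, meaningful at bounded functions. -/
noncomputable def nonlinL2 (p : ℝ) (f : L2) : L2 := toL2 fun x => nonlin p (f x)

/-- The potential `(p + 2)⁻¹ ∫ |f|^(p + 2)`. -/
noncomputable def potential (p : ℝ) (f : L2) : ℝ := (p + 2)⁻¹ * (inner ℂ f (nonlinL2 p f)).re

section NonlinL2

variable {f f₁ f₂ : L2} {K : ℝ}

theorem coeFn_nonlinL2 (hp : 0 ≤ p) (hf : ∀ᵐ x, ‖f x‖ ≤ K) :
    nonlinL2 p f =ᵐ[volume] fun x => nonlin p (f x) := by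
  refine coeFn_toL2 ((Lp.memLp f).of_le_mul (c := K ^ p)
    ((continuous_nonlin hp).comp_aestronglyMeasurable (Lp.aestronglyMeasurable f)) ?_)
  filter_upwards [hf] with x hx
  rw [norm_nonlin]
  gcongr

theorem norm_nonlinL2_le (hp : 0 ≤ p) (hf : ∀ᵐ x, ‖f x‖ ≤ K) :
    ‖nonlinL2 p f‖ ≤ K ^ p * ‖f‖ := by
  refine Lp.norm_le_mul_norm_of_ae_le_mul ?_
  filter_upwards [hf, coeFn_nonlinL2 hp hf] with x hx h
  rw [h, norm_nonlin]
  gcongr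

theorem norm_nonlinL2_sub_le (hp : 1 < p) (h₁ : ∀ᵐ x, ‖f₁ x‖ ≤ K) (h₂ : ∀ᵐ x, ‖f₂ x‖ ≤ K) :
    ‖nonlinL2 p f₁ - nonlinL2 p f₂‖ ≤ (p + 1) * K ^ p * ‖f₁ - f₂‖ := by
  refine Lp.norm_le_mul_norm_of_ae_le_mul ?_
  filter_upwards [h₁, h₂, coeFn_nonlinL2 (by linarith) h₁, coeFn_nonlinL2 (by linarith) h₂,
    Lp.coeFn_sub f₁ f₂, Lp.coeFn_sub (nonlinL2 p f₁) (nonlinL2 p f₂)] with x b1 b2 e1 e2 e3 e4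
  rw [e3, e4, Pi.sub_apply, Pi.sub_apply, e1, e2]
  exact norm_nonlin_sub_le hp b1 b2

theorem inner_nonlinL2_self (hp : 0 ≤ p) (hf : ∀ᵐ x, ‖f x‖ ≤ K) :
    inner ℂ f (nonlinL2 p f) = ((∫ x, ‖f x‖ ^ (p + 2) : ℝ) : ℂ) := by
  rw [L2.inner_def, ← integral_complex_ofReal]
  refine integral_congr_ae ?_
  filter_upwards [coeFn_nonlinL2 hp hf] with x h
  rw [h, inner_nonlin_self hp]

theorem inner_nonlinL2_self_im (hp : 0 ≤ p) (hf : ∀ᵐ x, ‖f x‖ ≤ K) :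
    (inner ℂ f (nonlinL2 p f)).im = 0 := by
  rw [inner_nonlinL2_self hp hf, Complex.ofReal_im]

theorem inner_nonlinL2_self_re (hp : 0 ≤ p) :
    (inner ℂ f (nonlinL2 p f)).re = (p + 2) * potential p f := by
  rw [potential, mul_inv_cancel_left₀ (by linarith)]

theorem potential_nonneg (hp : 0 ≤ p) (hf : ∀ᵐ x, ‖f x‖ ≤ K) : 0 ≤ potential p f := by
  rw [potential, inner_nonlinL2_self hp hf, Complex.ofReal_re]
  have : 0 ≤ ∫ x, ‖f x‖ ^ (p + 2) := integral_nonneg fun x => by positivity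
  positivity

theorem integrable_norm_rpow (hp : 0 ≤ p) (hf : ∀ᵐ x, ‖f x‖ ≤ K) :
    Integrable fun x => ‖f x‖ ^ (p + 2) := by
  refine (L2.integrable_inner (𝕜 := ℂ) f (nonlinL2 p f)).re.congr ?_
  filter_upwards [coeFn_nonlinL2 hp hf] with x h
  rw [h, inner_nonlin_self hp]
  exact Complex.ofReal_re _

theorem potential_eq (hp : 0 ≤ p) (hf : ∀ᵐ x, ‖f x‖ ≤ K) :
    potential p f = (p + 2)⁻¹ * ∫ x, ‖f x‖ ^ (p + 2) := by
  rw [potential, inner_nonlinL2_self hp hf, Complex.ofReal_re]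

/-- Convexity of the potential. -/
theorem re_inner_nonlinL2_le (hp : 0 ≤ p) (h₁ : ∀ᵐ x, ‖f₁ x‖ ≤ K) (h₂ : ∀ᵐ x, ‖f₂ x‖ ≤ K) :
    (inner ℂ (nonlinL2 p f₁) (f₂ - f₁)).re ≤ potential p f₂ - potential p f₁ := by
  rw [potential_eq hp h₁, potential_eq hp h₂, ← mul_sub,
    ← integral_sub (integrable_norm_rpow hp h₂) (integrable_norm_rpow hp h₁),
    le_inv_mul_iff₀ (by linarith), L2.inner_def, ← RCLike.re_eq_complex_re,
    ← integral_re (L2.integrable_inner _ _), ← integral_const_mul]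
  refine integral_mono_ae ((L2.integrable_inner _ _).re.const_mul _)
    ((integrable_norm_rpow hp h₂).sub (integrable_norm_rpow hp h₁)) ?_
  filter_upwards [coeFn_nonlinL2 hp h₁, Lp.coeFn_sub f₂ f₁] with x e1 e2
  rw [e1, e2]
  exact re_inner_nonlin_le hp _ _

/-- Convexity at `f₂` bounds the difference by the gradient at `f₂` alone. This controls the
oscillation of the potential by the L² distance. -/
theorem potential_sub_le (hp : 0 ≤ p) (h₁ : ∀ᵐ x, ‖f₁ x‖ ≤ K) (h₂ : ∀ᵐ x, ‖f₂ x‖ ≤ K) :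
    potential p f₂ - potential p f₁ ≤ K ^ p * ‖f₂‖ * ‖f₂ - f₁‖ := by
  have h := re_inner_nonlinL2_le hp h₂ h₁
  have h3 : -(inner ℂ (nonlinL2 p f₂) (f₁ - f₂)).re ≤ ‖nonlinL2 p f₂‖ * ‖f₁ - f₂‖ :=
    (neg_le_abs _).trans ((Complex.abs_re_le_norm _).trans (norm_inner_le_norm _ _))
  rw [norm_sub_rev] at h3
  have h4 := mul_le_mul_of_nonneg_right (norm_nonlinL2_le hp h₂) (norm_nonneg (f₂ - f₁))
  linarith

theorem potential_le (hp : 0 ≤ p) (hf : ∀ᵐ x, ‖f x‖ ≤ K) :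
    potential p f ≤ K ^ p * ‖f‖ ^ 2 := by
  have h1 : (inner ℂ f (nonlinL2 p f)).re ≤ ‖f‖ * (K ^ p * ‖f‖) :=
    (Complex.re_le_norm _).trans ((norm_inner_le_norm _ _).trans
      (mul_le_mul_of_nonneg_left (norm_nonlinL2_le hp hf) (norm_nonneg _)))
  rw [inner_nonlinL2_self_re hp] at h1
  nlinarith [potential_nonneg hp hf]

/-- Convexity at `f₁` gives the Taylor remainder a sign. Convexity at `f₂` bounds it by the pairing
of the gradient increment with `f₂ - f₁`, which is quadratic by the Lipschitz estimate. No
differentiation of the potential is needed. -/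
theorem abs_re_inner_nonlinL2_sub_le (hp : 1 < p) (h₁ : ∀ᵐ x, ‖f₁ x‖ ≤ K)
    (h₂ : ∀ᵐ x, ‖f₂ x‖ ≤ K) {c : ℝ} (hc0 : 0 ≤ c) (hc1 : c ≤ 1) :
    |(inner ℂ ((c : ℂ) • nonlinL2 p f₁) (f₂ - f₁)).re - c * (potential p f₂ - potential p f₁)| ≤
      (p + 1) * K ^ p * ‖f₂ - f₁‖ ^ 2 := by
  have hp0 : 0 ≤ p := by linarith
  have a1 := re_inner_nonlinL2_le hp0 h₁ h₂
  have a2 := re_inner_nonlinL2_le hp0 h₂ h₁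
  have a3 : (inner ℂ (nonlinL2 p f₂ - nonlinL2 p f₁) (f₂ - f₁)).re ≤
      (p + 1) * K ^ p * ‖f₂ - f₁‖ ^ 2 := by
    refine (Complex.re_le_norm _).trans ((norm_inner_le_norm _ _).trans ?_)
    rw [sq, ← mul_assoc]
    gcongr
    exact norm_nonlinL2_sub_le hp h₂ h₁
  rw [inner_sub_left, Complex.sub_re] at a3
  rw [← neg_sub f₂ f₁, inner_neg_right, Complex.neg_re] at a2
  have e : (inner ℂ ((c : ℂ) • nonlinL2 p f₁) (f₂ - f₁)).re =
      c * (inner ℂ (nonlinL2 p f₁) (f₂ - f₁)).re := by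
    rw [inner_smul_left, Complex.conj_ofReal, Complex.re_ofReal_mul]
  rw [e, ← mul_sub, abs_mul, abs_of_nonneg hc0]
  refine (mul_le_of_le_one_left (abs_nonneg _) hc1).trans ?_
  rw [abs_le]
  constructor <;> linarith

end NonlinL2

end Nonlinearity

/-! ### The space Σ as a graph, and the link with the abstract equation -/

section SigmaSpace

variable {f g : ℝ → ℂ}

theorem MemSigma.sub (hf : MemSigma f) (hg : MemSigma g) : MemSigma (fun x => f x - g x) := by
  refine ⟨hf.1.sub hg.1, ⟨_, hf.hasWeakDeriv.sub hg.hasWeakDeriv,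
    hf.memLp_weakDeriv.sub hg.memLp_weakDeriv⟩, ?_⟩
  simp only [mul_sub]
  exact hf.2.2.sub hg.2.2

theorem weakDeriv_sub (hf : MemSigma f) (hg : MemSigma g) :
    weakDeriv (fun x => f x - g x) =ᵐ[volume] fun x => weakDeriv f x - weakDeriv g x :=
  (hf.hasWeakDeriv.sub hg.hasWeakDeriv).weakDeriv_ae_eq

/-- The pair `(f', x f)` in `L² × L²`. -/
noncomputable def toGrad (f : ℝ → ℂ) : WithLp 2 (L2 × L2) :=
  WithLp.toLp 2 (toL2 (weakDeriv f), toL2 fun x : ℝ => (x : ℂ) * f x)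

theorem toGrad_sub (hf : MemSigma f) (hg : MemSigma g) :
    toGrad (fun x => f x - g x) = toGrad f - toGrad g := by
  have e1 : toL2 (weakDeriv fun x => f x - g x) = toL2 (weakDeriv f) - toL2 (weakDeriv g) := by
    rw [← toL2_sub hf.memLp_weakDeriv hg.memLp_weakDeriv]
    exact toL2_congr (hf.sub hg).memLp_weakDeriv (weakDeriv_sub hf hg)
  have e2 : toL2 (fun x : ℝ => (x : ℂ) * (f x - g x)) =
      toL2 (fun x : ℝ => (x : ℂ) * f x) - toL2 (fun x : ℝ => (x : ℂ) * g x) := by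
    rw [← toL2_sub hf.2.2 hg.2.2]
    simp only [mul_sub]
  rw [toGrad, e1, e2]
  rfl

theorem toGrad_fst : (toGrad f).fst = toL2 (weakDeriv f) := rfl

theorem toGrad_snd : (toGrad f).snd = toL2 fun x : ℝ => (x : ℂ) * f x := rfl

theorem MemSigma.norm_toL2_add_le (hf : MemSigma f) :
    ‖toL2 f‖ + ‖toGrad f‖ ≤ (sigmaNorm f).toReal := by
  have h : ‖toGrad f‖ ≤ ‖toL2 (weakDeriv f)‖ + ‖toL2 fun x : ℝ => (x : ℂ) * f x‖ := by
    rw [WithLp.prod_norm_eq_of_L2]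
    refine Real.sqrt_le_iff.2 ⟨by positivity, ?_⟩
    rw [toGrad_fst, toGrad_snd]
    nlinarith [mul_nonneg (norm_nonneg (toL2 (weakDeriv f))) (norm_nonneg (toL2 fun x : ℝ => (x : ℂ) * f x))]
  rw [sigmaNorm, ENNReal.toReal_add (ENNReal.add_ne_top.2 ⟨hf.1.eLpNorm_ne_top,
      hf.memLp_weakDeriv.eLpNorm_ne_top⟩) hf.2.2.eLpNorm_ne_top,
    ENNReal.toReal_add hf.1.eLpNorm_ne_top hf.memLp_weakDeriv.eLpNorm_ne_top,
    ← norm_toL2 hf.1, ← norm_toL2 hf.memLp_weakDeriv, ← norm_toL2 hf.2.2]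
  linarith

theorem exists_norm_le_sigma : ∃ K : ℝ, 0 ≤ K ∧ ∀ f : ℝ → ℂ, MemSigma f →
    ∀ᵐ x, ‖toL2 f x‖ ≤ K * (‖toL2 f‖ + ‖toGrad f‖) := by
  obtain ⟨K, hK, h⟩ := exists_norm_le_of_hasWeakDeriv
  refine ⟨K, hK, fun f hf => ?_⟩
  filter_upwards [h f _ hf.hasWeakDeriv hf.1 hf.memLp_weakDeriv, coeFn_toL2 hf.1] with x hx e
  rw [e]
  refine hx.trans (mul_le_mul_of_nonneg_left ?_ hK)
  rw [← norm_toL2 hf.1, ← norm_toL2 hf.memLp_weakDeriv]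
  gcongr
  exact WithLp.norm_fst_le _ (toGrad f)

/-- The graph of `f ↦ (f', x f)` in `L²`. -/
def sigmaGraph : Submodule ℂ (L2 × WithLp 2 (L2 × L2)) where
  carrier := {q | HasWeakDeriv q.1 q.2.fst ∧ q.2.snd =ᵐ[volume] fun x : ℝ => (x : ℂ) * q.1 x}
  zero_mem' := by
    constructor
    · exact hasWeakDeriv_zero.congr (Lp.coeFn_zero ℂ 2 volume).symm (Lp.coeFn_zero ℂ 2 volume).symm
    · filter_upwards [Lp.coeFn_zero ℂ 2 (volume : Measure ℝ)] with x hx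
      simp
  add_mem' := by
    rintro q r ⟨hq1, hq2⟩ ⟨hr1, hr2⟩
    constructor
    · exact (hq1.add hr1).congr (Lp.coeFn_add _ _).symm (Lp.coeFn_add _ _).symm
    · filter_upwards [hq2, hr2, Lp.coeFn_add q.1 r.1, Lp.coeFn_add q.2.snd r.2.snd]
        with x h1 h2 h3 h4
      rw [Prod.snd_add, Prod.fst_add, WithLp.add_snd, h4, h3, Pi.add_apply, Pi.add_apply, h1, h2,
        mul_add]
  smul_mem' := by
    rintro c q ⟨hq1, hq2⟩
    constructor
    · exact (hq1.const_smul c).congr (Lp.coeFn_smul _ _).symm (Lp.coeFn_smul _ _).symm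
    · filter_upwards [hq2, Lp.coeFn_smul c q.1, Lp.coeFn_smul c q.2.snd] with x h1 h2 h3
      rw [Prod.smul_snd, Prod.smul_fst, WithLp.smul_snd, h3, h2, Pi.smul_apply, Pi.smul_apply, h1,
        smul_eq_mul, smul_eq_mul, mul_left_comm]

theorem MemSigma.mem_sigmaGraph (hf : MemSigma f) : (toL2 f, toGrad f) ∈ sigmaGraph := by
  constructor
  · exact hf.hasWeakDeriv.congr (coeFn_toL2 hf.1).symm (coeFn_toL2 hf.memLp_weakDeriv).symm
  · filter_upwards [coeFn_toL2 hf.1, coeFn_toL2 hf.2.2] with x h1 h2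
    rw [toGrad_snd, h1, h2]

theorem memSigma_of_mem_sigmaGraph {q : L2 × WithLp 2 (L2 × L2)} (hq : q ∈ sigmaGraph) :
    MemSigma q.1 :=
  ⟨Lp.memLp _, ⟨_, hq.1, Lp.memLp _⟩, (Lp.memLp _).ae_eq hq.2⟩

theorem integral_mul_conj_eq_inner (φ : L2) (hf : MemLp f 2 volume) :
    ∫ x, f x * conj (φ x) = inner ℂ φ (toL2 f) := by
  rw [L2.inner_def]
  refine integral_congr_ae ?_
  filter_upwards [coeFn_toL2 hf] with x hx
  rw [hx, RCLike.inner_apply]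

/-- One factor `x` of the weight `x²` goes to each side of the pairing, so that the kinetic and
harmonic terms form a single inner product of `(f', x f)` pairs. -/
theorem weakRHS_eq_inner {a p K : ℝ} (hp : 0 ≤ p) (hf : MemSigma f) (hK : ∀ᵐ x, ‖toL2 f x‖ ≤ K)
    {q : L2 × WithLp 2 (L2 × L2)} (hq : q ∈ sigmaGraph) :
    weakRHS a p f q.1 = (1 / 2) * inner ℂ q.2 (toGrad f) +
      inner ℂ q.1 ((a : ℂ) • nonlinL2 p (toL2 f)) := by
  have e1 : ∫ x, weakDeriv f x * conj (weakDeriv q.1 x) = inner ℂ q.2.fst (toL2 (weakDeriv f)) := by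
    rw [← integral_mul_conj_eq_inner _ hf.memLp_weakDeriv]
    refine integral_congr_ae ?_
    filter_upwards [hq.1.weakDeriv_ae_eq] with x hx
    rw [hx]
  have e2 : ∫ x : ℝ, (x : ℂ) ^ 2 * f x * conj (q.1 x) =
      inner ℂ q.2.snd (toL2 fun x : ℝ => (x : ℂ) * f x) := by
    rw [← integral_mul_conj_eq_inner _ hf.2.2]
    refine integral_congr_ae ?_
    filter_upwards [hq.2] with x hx
    rw [hx, map_mul, Complex.conj_ofReal]
    ring
  have e3 : ∫ x, ((‖f x‖ ^ p : ℝ) : ℂ) * f x * conj (q.1 x) =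
      inner ℂ q.1 (nonlinL2 p (toL2 f)) := by
    rw [L2.inner_def]
    refine integral_congr_ae ?_
    filter_upwards [coeFn_nonlinL2 hp hK, coeFn_toL2 hf.1] with x h1 h2
    rw [h1, h2, RCLike.inner_apply, nonlin]
  have e4 : inner ℂ q.2 (toGrad f) = inner ℂ q.2.fst (toL2 (weakDeriv f)) +
      inner ℂ q.2.snd (toL2 fun x : ℝ => (x : ℂ) * f x) := rfl
  rw [weakRHS, e1, e2, e3, e4, inner_smul_right]
  ring

/-- Continuity in Σ on the compact time interval gives a common sup bound through the Sobolev
embedding. On such a bounded set the nonlinearity is Lipschitz in L², hence continuous in time. -/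
theorem IsSolution.isWeakSol {a : ℝ → ℝ} {p : ℝ} {v₀ : ℝ → ℂ} {v : ℝ → ℝ → ℂ}
    (h : IsSolution a p v₀ v) (hp : 1 < p) (ha : Continuous a) :
    IsWeakSol sigmaGraph timeInterval (fun t => toL2 (v t)) (fun t => toGrad (v t))
      (fun t => (a t : ℂ) • nonlinL2 p (toL2 (v t))) := by
  have hp0 : 0 ≤ p := by linarith
  obtain ⟨K, hK, hSob⟩ := exists_norm_le_sigma
  have hlim : ∀ t ∈ timeInterval, Tendsto (fun s => (sigmaNorm fun x => v s x - v t x).toReal)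
      (𝓝[timeInterval] t) (𝓝 0) := fun t ht => by
    simpa [Function.comp_def] using
      (ENNReal.tendsto_toReal ENNReal.zero_ne_top).comp (h.continuous t ht)
  have hle : ∀ t ∈ timeInterval, ∀ s ∈ timeInterval,
      ‖toL2 (v s) - toL2 (v t)‖ + ‖toGrad (v s) - toGrad (v t)‖ ≤
        (sigmaNorm fun x => v s x - v t x).toReal := fun t ht s hs => by
    have hs' := h.memSigma s hs
    have ht' := h.memSigma t ht
    rw [← toL2_sub hs'.1 ht'.1, ← toGrad_sub hs' ht']
    exact (hs'.sub ht').norm_toL2_add_le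
  have cU : ContinuousOn (fun t => toL2 (v t)) timeInterval := fun t ht => by
    refine tendsto_iff_norm_sub_tendsto_zero.2 (squeeze_zero' (Eventually.of_forall fun _ =>
      norm_nonneg _) ?_ (hlim t ht))
    filter_upwards [self_mem_nhdsWithin] with s hs
    exact (le_add_of_nonneg_right (norm_nonneg _)).trans (hle t ht s hs)
  have cW : ContinuousOn (fun t => toGrad (v t)) timeInterval := fun t ht => by
    refine tendsto_iff_norm_sub_tendsto_zero.2 (squeeze_zero' (Eventually.of_forall fun _ =>
      norm_nonneg _) ?_ (hlim t ht))
    filter_upwards [self_mem_nhdsWithin] with s hs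
    exact (le_add_of_nonneg_left (norm_nonneg _)).trans (hle t ht s hs)
  obtain ⟨M₁, hM₁⟩ := isCompact_Icc.exists_bound_of_continuousOn cU
  obtain ⟨M₂, hM₂⟩ := isCompact_Icc.exists_bound_of_continuousOn cW
  have hbd : ∀ t ∈ timeInterval, ∀ᵐ x, ‖toL2 (v t) x‖ ≤ K * (M₁ + M₂) := fun t ht => by
    filter_upwards [hSob _ (h.memSigma t ht)] with x hx
    exact hx.trans (mul_le_mul_of_nonneg_left (add_le_add (hM₁ t ht) (hM₂ t ht)) hK)
  have cN : ContinuousOn (fun t => nonlinL2 p (toL2 (v t))) timeInterval := fun t ht => by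
    refine tendsto_iff_norm_sub_tendsto_zero.2 (squeeze_zero' (Eventually.of_forall fun _ =>
      norm_nonneg _) ?_ (g := fun s => (p + 1) * (K * (M₁ + M₂)) ^ p * ‖toL2 (v s) - toL2 (v t)‖) ?_)
    · filter_upwards [self_mem_nhdsWithin] with s hs
      exact norm_nonlinL2_sub_le hp (hbd s hs) (hbd t ht)
    · have := (tendsto_iff_norm_sub_tendsto_zero.1 (cU t ht)).const_mul
        ((p + 1) * (K * (M₁ + M₂)) ^ p)
      rwa [mul_zero] at this
  refine ⟨fun t ht => (h.memSigma t ht).mem_sigmaGraph, cU, cW,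
    (Complex.continuous_ofReal.comp ha).continuousOn.smul cN, fun t ht q hq => ?_⟩
  rw [← weakRHS_eq_inner hp0 (h.memSigma t ht) (hbd t ht) hq]
  refine (h.equation t ht _ (memSigma_of_mem_sigmaGraph hq)).congr (fun s hs => ?_) ?_
  · exact (integral_mul_conj_eq_inner _ (h.memSigma s hs).1).symm
  · exact (integral_mul_conj_eq_inner _ (h.memSigma t ht).1).symm

theorem sigmaNorm_congr (hf : MemSigma f) (h : f =ᵐ[volume] g) : sigmaNorm f = sigmaNorm g := by
  have e1 : weakDeriv g =ᵐ[volume] weakDeriv f :=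
    (hf.hasWeakDeriv.congr h (ae_eq_refl _)).weakDeriv_ae_eq
  rw [sigmaNorm, sigmaNorm, eLpNorm_congr_ae h, eLpNorm_congr_ae e1,
    eLpNorm_congr_ae (f := fun x : ℝ => (x : ℂ) * f x) (g := fun x : ℝ => (x : ℂ) * g x) (h.mono fun x hx => by simp only [hx])]

end SigmaSpace

/-! ### The family of equations with coefficient (cos t)^ε -/

section CosSol

/-- If the bound failed, there would be a first time at which `f` equals `M`; up to that time the
bound holds, and `h` makes the inequality strict there. -/
theorem le_of_bootstrap {f : ℝ → ℝ} {a b M : ℝ} (hf : ContinuousOn f (Icc a b)) (ha : f a ≤ M)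
    (h : ∀ t ∈ Icc a b, (∀ s ∈ Icc a t, f s ≤ M) → f t < M) : ∀ t ∈ Icc a b, f t ≤ M := by
  intro t ht
  by_contra! hlt
  have ivt : ∀ s ∈ Icc a t, M < f s → ∃ r ∈ Icc a s, f r = M := fun s hs hMs =>
    intermediate_value_Icc hs.1 (hf.mono (Icc_subset_Icc_right (hs.2.trans ht.2))) ⟨ha, hMs.le⟩
  have hft : ContinuousOn f (Icc a t) := hf.mono (Icc_subset_Icc_right ht.2)
  have hcomp : IsCompact (Icc a t ∩ f ⁻¹' {M}) :=
    isCompact_Icc.of_isClosed_subset (hft.preimage_isClosed_of_isClosed isClosed_Icc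
      isClosed_singleton) inter_subset_left
  obtain ⟨r, hr, hrM⟩ := ivt t (right_mem_Icc.2 ht.1) hlt
  obtain ⟨c, ⟨hc, hcM⟩, hmin⟩ := hcomp.exists_isLeast ⟨r, hr, hrM⟩
  refine (h c ⟨hc.1, hc.2.trans ht.2⟩ fun s hs => ?_).ne hcM
  by_contra! hMs
  obtain ⟨q, hq, hqM⟩ := ivt s ⟨hs.1, hs.2.trans hc.2⟩ hMs
  have hcq : c ≤ q := hmin ⟨⟨hq.1, hq.2.trans (hs.2.trans hc.2)⟩, hqM⟩
  have hsc : s = c := le_antisymm hs.2 (hcq.trans hq.2)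
  rw [hsc] at hMs
  exact hMs.ne' hcM

theorem hasDerivAt_cos_rpow {ε t : ℝ} (ht : t ∈ Ioo (-(Real.pi / 2)) (Real.pi / 2)) :
    HasDerivAt (fun t => Real.cos t ^ ε) (-Real.sin t * ε * Real.cos t ^ (ε - 1)) t :=
  (Real.hasDerivAt_cos t).rpow_const (Or.inl (Real.cos_pos_of_mem_Ioo ht).ne')

theorem continuousOn_deriv_cos_rpow {ε : ℝ} :
    ContinuousOn (fun t => -Real.sin t * ε * Real.cos t ^ (ε - 1))
      (Ioo (-(Real.pi / 2)) (Real.pi / 2)) :=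
  (by fun_prop : ContinuousOn (fun t => -Real.sin t * ε) _).mul
    (Real.continuous_cos.continuousOn.rpow_const
      fun t ht => Or.inl (Real.cos_pos_of_mem_Ioo ht).ne')

variable {G : Type*} [NormedAddCommGroup G] [InnerProductSpace ℂ G]

/-- A weak solution of the equation with nonlinearity `(cos t)^ε |u|^(4 + 2ε) u`, whose values are
controlled by a Sobolev inequality with constant `K`, and whose initial value has norm at most `R`.
The principal part of the equation is abstract. -/
structure IsCosSol (K R ε : ℝ) (V : Submodule ℂ (L2 × G)) (u : ℝ → L2) (w : ℝ → G) : Prop where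
  sol : IsWeakSol V (Icc (-(Real.pi / 2)) (Real.pi / 2)) u w
    (fun t => ((Real.cos t ^ ε : ℝ) : ℂ) • nonlinL2 (4 + 2 * ε) (u t))
  sobolev : ∀ t ∈ Icc (-(Real.pi / 2)) (Real.pi / 2), ∀ᵐ x, ‖u t x‖ ≤ K * (‖u t‖ + ‖w t‖)
  initial : ‖u (-(Real.pi / 2))‖ + ‖w (-(Real.pi / 2))‖ ≤ R
  one_le_K : 1 ≤ K
  one_le_R : 1 ≤ R
  eps_nonneg : 0 ≤ ε
  eps_le_one : ε ≤ 1

/-- The energy. -/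
noncomputable def energy (ε : ℝ) (u : ℝ → L2) (w : ℝ → G) (t : ℝ) : ℝ :=
  1 / 2 * ‖w t‖ ^ 2 + 2 * Real.cos t ^ ε * potential (4 + 2 * ε) (u t)

namespace IsCosSol

variable {K R ε M : ℝ} {V : Submodule ℂ (L2 × G)} {u : ℝ → L2} {w : ℝ → G} {s t : ℝ}

theorem cos_rpow_nonneg (ht : t ∈ Icc (-(Real.pi / 2)) (Real.pi / 2)) :
    0 ≤ Real.cos t ^ ε :=
  Real.rpow_nonneg (Real.cos_nonneg_of_mem_Icc ht) _

theorem cos_rpow_le_one (h : IsCosSol K R ε V u w) (ht : t ∈ Icc (-(Real.pi / 2)) (Real.pi / 2)) :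
    Real.cos t ^ ε ≤ 1 :=
  Real.rpow_le_one (Real.cos_nonneg_of_mem_Icc ht) (Real.cos_le_one t) h.eps_nonneg

theorem left_mem : -(Real.pi / 2) ∈ Icc (-(Real.pi / 2)) (Real.pi / 2) :=
  left_mem_Icc.2 (by linarith [Real.pi_pos])

theorem norm_eq (h : IsCosSol K R ε V u w) (ht : t ∈ Icc (-(Real.pi / 2)) (Real.pi / 2)) :
    ‖u t‖ = ‖u (-(Real.pi / 2))‖ := by
  refine h.sol.norm_eq_of_inner_im_eq_zero (fun s hs => ?_) ht
  rw [inner_smul_right, Complex.im_ofReal_mul,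
    inner_nonlinL2_self_im (by linarith [h.eps_nonneg]) (h.sobolev s hs), mul_zero]

theorem norm_le (h : IsCosSol K R ε V u w) (ht : t ∈ Icc (-(Real.pi / 2)) (Real.pi / 2)) :
    ‖u t‖ ≤ R := by
  rw [h.norm_eq ht]
  linarith [h.initial, norm_nonneg (w (-(Real.pi / 2)))]

theorem ae_norm_le (h : IsCosSol K R ε V u w) (ht : t ∈ Icc (-(Real.pi / 2)) (Real.pi / 2))
    (hM : ‖w t‖ ≤ M) : ∀ᵐ x, ‖u t x‖ ≤ K * (R + M) := by
  filter_upwards [h.sobolev t ht] with x hx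
  have := h.one_le_K
  exact hx.trans (by gcongr; exact h.norm_le ht)

theorem exists_ae_norm_le (h : IsCosSol K R ε V u w) :
    ∃ S, ∀ t ∈ Icc (-(Real.pi / 2)) (Real.pi / 2), ∀ᵐ x, ‖u t x‖ ≤ S := by
  obtain ⟨M, hM⟩ := isCompact_Icc.exists_bound_of_continuousOn h.sol.contW
  exact ⟨K * (R + M), fun t ht => h.ae_norm_le ht (hM t ht)⟩

theorem rpow_le_pow_six (h : IsCosSol K R ε V u w) {S : ℝ} (hS : 1 ≤ S) :
    S ^ (4 + 2 * ε) ≤ S ^ 6 := by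
  rw [← Real.rpow_natCast S 6]
  refine Real.rpow_le_rpow_of_exponent_le hS ?_
  push_cast
  linarith [h.eps_le_one]

theorem continuousOn_potential (h : IsCosSol K R ε V u w) :
    ContinuousOn (fun t => potential (4 + 2 * ε) (u t)) (Icc (-(Real.pi / 2)) (Real.pi / 2)) := by
  obtain ⟨S, hS⟩ := h.exists_ae_norm_le
  have hp : 0 ≤ 4 + 2 * ε := by linarith [h.eps_nonneg]
  have hS0 : 0 ≤ S := by
    obtain ⟨x, hx⟩ := (hS _ left_mem).exists
    exact (norm_nonneg _).trans hx
  intro t ht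
  refine tendsto_iff_norm_sub_tendsto_zero.2 (squeeze_zero' (Eventually.of_forall fun _ =>
    norm_nonneg _) ?_ (g := fun s => S ^ (4 + 2 * ε) * R * ‖u s - u t‖) ?_)
  · filter_upwards [self_mem_nhdsWithin] with s hs
    have h1 := potential_sub_le hp (hS s hs) (hS t ht)
    have h2 := potential_sub_le hp (hS t ht) (hS s hs)
    have h3 : S ^ (4 + 2 * ε) * ‖u s‖ * ‖u s - u t‖ ≤ S ^ (4 + 2 * ε) * R * ‖u s - u t‖ := by
      gcongr; exact h.norm_le hs
    have h4 : S ^ (4 + 2 * ε) * ‖u t‖ * ‖u s - u t‖ ≤ S ^ (4 + 2 * ε) * R * ‖u s - u t‖ := by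
      gcongr; exact h.norm_le ht
    rw [norm_sub_rev] at h1
    rw [Real.norm_eq_abs, abs_le]
    constructor <;> linarith
  · have := (tendsto_iff_norm_sub_tendsto_zero.1 (h.sol.contU t ht)).const_mul
      (S ^ (4 + 2 * ε) * R)
    rwa [mul_zero] at this

theorem potential_nonneg (h : IsCosSol K R ε V u w)
    (ht : t ∈ Icc (-(Real.pi / 2)) (Real.pi / 2)) : 0 ≤ potential (4 + 2 * ε) (u t) :=
  HarmonicNLS.potential_nonneg (by linarith [h.eps_nonneg]) (h.sobolev t ht)

theorem continuous_cos_rpow (h : IsCosSol K R ε V u w) : Continuous fun t => Real.cos t ^ ε :=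
  Real.continuous_cos.rpow_const fun _ => Or.inr h.eps_nonneg

theorem continuousOn_energy (h : IsCosSol K R ε V u w) :
    ContinuousOn (energy ε u w) (Icc (-(Real.pi / 2)) (Real.pi / 2)) :=
  ((h.sol.contW.norm.pow 2).const_mul (1 / 2)).add
    ((continuous_const.mul h.continuous_cos_rpow).continuousOn.mul h.continuousOn_potential)

theorem hasDerivAt_energy (h : IsCosSol K R ε V u w)
    (ht : t ∈ Ioo (-(Real.pi / 2)) (Real.pi / 2)) :
    HasDerivAt (energy ε u w) (2 * (-Real.sin t * ε * Real.cos t ^ (ε - 1)) *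
      potential (4 + 2 * ε) (u t)) t := by
  obtain ⟨S, hS⟩ := h.exists_ae_norm_le
  have hε := h.eps_nonneg
  refine h.sol.hasDerivAt_energy (p := 4 + 2 * ε) (A := fun t => Real.cos t ^ ε)
    (A' := fun t => -Real.sin t * ε * Real.cos t ^ (ε - 1))
    (P := fun t => potential (4 + 2 * ε) (u t)) (fun t ht => hasDerivAt_cos_rpow ht)
    continuousOn_deriv_cos_rpow h.continuousOn_potential (fun t ht => ?_)
    (L := (4 + 2 * ε + 1) * S ^ (4 + 2 * ε)) (fun s hs t ht => ?_) ht
  · rw [inner_smul_right, Complex.re_ofReal_mul, inner_nonlinL2_self_re (by linarith)]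
    ring
  · exact abs_re_inner_nonlinL2_sub_le (by linarith) (hS t ht) (hS s hs)
      (cos_rpow_nonneg ht) (h.cos_rpow_le_one ht)

theorem half_norm_sq_le_energy (h : IsCosSol K R ε V u w)
    (ht : t ∈ Icc (-(Real.pi / 2)) (Real.pi / 2)) : 1 / 2 * ‖w t‖ ^ 2 ≤ energy ε u w t := by
  have := mul_nonneg (cos_rpow_nonneg (ε := ε) ht) (h.potential_nonneg ht)
  rw [energy]
  linarith

/-- Since `(cos t)^ε` is nondecreasing for `t ≤ 0`, the growth of `½ ‖w‖²` is controlled by the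
oscillation of the potential. -/
theorem half_norm_sq_le_of_potential_le (h : IsCosSol K R ε V u w)
    (ht : t ∈ Icc (-(Real.pi / 2)) 0) {d : ℝ} (hd0 : 0 ≤ d)
    (hP : ∀ s ∈ Icc (-(Real.pi / 2)) t,
      potential (4 + 2 * ε) (u s) ≤ potential (4 + 2 * ε) (u t) + d) :
    1 / 2 * ‖w t‖ ^ 2 ≤ 1 / 2 * ‖w (-(Real.pi / 2))‖ ^ 2 + 2 * d := by
  have hπ := Real.pi_pos
  have hsub : Icc (-(Real.pi / 2)) t ⊆ Icc (-(Real.pi / 2)) (Real.pi / 2) :=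
    Icc_subset_Icc_right (by linarith [ht.2])
  -- Subtracting `2 Q (cos s)^ε` turns the energy law into the derivative `2 ((cos s)^ε)' (P(s) -
  -- Q)`, which is nonpositive for `s ≤ 0`, whatever the size of the singular factor.
  set Q := potential (4 + 2 * ε) (u t) + d with hQ
  have hanti : AntitoneOn (fun s => energy ε u w s - 2 * Q * Real.cos s ^ ε)
      (Icc (-(Real.pi / 2)) t) := by
    have hd : ∀ s ∈ Ioo (-(Real.pi / 2)) t,
        HasDerivAt (fun s => energy ε u w s - 2 * Q * Real.cos s ^ ε)
          (2 * (-Real.sin s * ε * Real.cos s ^ (ε - 1)) * potential (4 + 2 * ε) (u s) -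
            2 * Q * (-Real.sin s * ε * Real.cos s ^ (ε - 1))) s := fun s hs => by
      have hs' : s ∈ Ioo (-(Real.pi / 2)) (Real.pi / 2) := ⟨hs.1, by linarith [hs.2, ht.2]⟩
      exact (h.hasDerivAt_energy hs').sub ((hasDerivAt_cos_rpow hs').const_mul _)
    refine antitoneOn_of_deriv_nonpos (convex_Icc _ _)
      ((h.continuousOn_energy.mono hsub).sub
        (continuous_const.mul h.continuous_cos_rpow).continuousOn) ?_ ?_
    · rw [interior_Icc]
      exact fun s hs => (hd s hs).differentiableAt.differentiableWithinAt
    · rw [interior_Icc]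
      intro s hs
      rw [(hd s hs).deriv]
      have h1 := hP s (Ioo_subset_Icc_self hs)
      have h2 : 0 ≤ -Real.sin s * ε * Real.cos s ^ (ε - 1) := by
        have h3 : Real.sin s ≤ 0 :=
          Real.sin_nonpos_of_nonpos_of_neg_pi_le (by linarith [hs.2, ht.2]) (by linarith [hs.1])
        have h4 : 0 ≤ Real.cos s :=
          Real.cos_nonneg_of_mem_Icc (hsub (Ioo_subset_Icc_self hs))
        have := h.eps_nonneg
        exact mul_nonneg (mul_nonneg (by linarith) this) (Real.rpow_nonneg h4 _)
      nlinarith [mul_nonneg h2 (sub_nonneg.2 h1)]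
  have := hanti (left_mem_Icc.2 ht.1) (right_mem_Icc.2 ht.1) ht.1
  simp only [energy] at this
  have h0 := hP _ (left_mem_Icc.2 ht.1)
  have ht' := hsub (right_mem_Icc.2 ht.1)
  have c0 := cos_rpow_nonneg (ε := ε) left_mem
  have c1 := h.cos_rpow_le_one ht'
  have e : Q * Real.cos t ^ ε = potential (4 + 2 * ε) (u t) * Real.cos t ^ ε +
      Real.cos t ^ ε * d := by rw [hQ]; ring
  linarith [mul_nonneg c0 (sub_nonneg.2 h0), mul_le_of_le_one_left hd0 c1]

end IsCosSol

end CosSol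

/-! ### Bounds independent of ε -/

section UniformBound

namespace IsCosSol

variable {G : Type*} [NormedAddCommGroup G] [InnerProductSpace ℂ G]
variable {K R ε M : ℝ} {V : Submodule ℂ (L2 × G)} {u : ℝ → L2} {w : ℝ → G} {s t : ℝ}

/-- The constant `S` bounds `|u|` as long as `‖w‖ ≤ R + 1`. -/
noncomputable def supBound (K R : ℝ) : ℝ := K * (R + (R + 1))

/-- A time, depending only on `K` and `R`, up to which `‖w‖ ≤ R + 1`. -/
noncomputable def shortTime (K R : ℝ) : ℝ :=
  (4 * supBound K R ^ 12 * R ^ 2 * ((R + 1) ^ 2 + 2 * R ^ 2 * supBound K R ^ 6))⁻¹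

theorem one_le_supBound (hK : 1 ≤ K) (hR : 1 ≤ R) : 1 ≤ supBound K R :=
  one_le_mul_of_one_le_of_one_le hK (by linarith)

theorem shortTime_pos (hK : 1 ≤ K) (hR : 1 ≤ R) : 0 < shortTime K R := by
  have := one_le_supBound hK hR
  rw [shortTime]
  positivity

theorem shortTime_le_one (hK : 1 ≤ K) (hR : 1 ≤ R) : shortTime K R ≤ 1 := by
  have hS := one_le_supBound hK hR
  refine inv_le_one_of_one_le₀ ?_
  have h1 : 1 ≤ supBound K R ^ 12 := one_le_pow₀ hS
  have h2 : 1 ≤ R ^ 2 := one_le_pow₀ hR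
  have h3 : 1 ≤ (R + 1) ^ 2 := one_le_pow₀ (by linarith)
  have h4 : 0 ≤ 2 * R ^ 2 * supBound K R ^ 6 := by positivity
  have h5 : 1 ≤ 4 * supBound K R ^ 12 := by linarith
  exact one_le_mul_of_one_le_of_one_le (one_le_mul_of_one_le_of_one_le h5 h2) (by linarith)

/-- The strict improvement for the bootstrap. As long as `‖w‖ ≤ R + 1`, `u` is bounded by `S` and
moves little in L², so the potential varies by at most 1/2. -/
theorem norm_w_lt (h : IsCosSol K R ε V u w)
    (ht : t ∈ Icc (-(Real.pi / 2)) (-(Real.pi / 2) + shortTime K R))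
    (hw : ∀ s ∈ Icc (-(Real.pi / 2)) t, ‖w s‖ ≤ R + 1) : ‖w t‖ < R + 1 := by
  have hK := h.one_le_K
  have hR := h.one_le_R
  have hδ := shortTime_le_one hK hR
  have hπ := Real.pi_gt_three
  have ht0 : t ∈ Icc (-(Real.pi / 2)) 0 := ⟨ht.1, by linarith [ht.2]⟩
  have hp : 0 ≤ 4 + 2 * ε := by linarith [h.eps_nonneg]
  set S := supBound K R with hS
  have hS1 : 1 ≤ S := one_le_supBound hK hR
  have hSp : S ^ (4 + 2 * ε) ≤ S ^ 6 := h.rpow_le_pow_six hS1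
  have hSp0 : 0 ≤ S ^ (4 + 2 * ε) := by positivity
  have hsub : Icc (-(Real.pi / 2)) t ⊆ Icc (-(Real.pi / 2)) (Real.pi / 2) :=
    Icc_subset_Icc_right (by linarith [ht0.2])
  have hbd : ∀ s ∈ Icc (-(Real.pi / 2)) t, ∀ᵐ x, ‖u s x‖ ≤ S := fun s hs =>
    h.ae_norm_le (hsub hs) (hw s hs)
  have htt : t ∈ Icc (-(Real.pi / 2)) t := right_mem_Icc.2 ht.1
  have hN : ∀ s ∈ Icc (-(Real.pi / 2)) t,
      ‖((Real.cos s ^ ε : ℝ) : ℂ) • nonlinL2 (4 + 2 * ε) (u s)‖ ≤ S ^ 6 * R := fun s hs => by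
    rw [norm_smul, Complex.norm_real, Real.norm_of_nonneg (cos_rpow_nonneg (hsub hs))]
    refine (mul_le_of_le_one_left (norm_nonneg _) (h.cos_rpow_le_one (hsub hs))).trans ?_
    refine (norm_nonlinL2_le hp (hbd s hs)).trans ?_
    gcongr
    exact h.norm_le (hsub hs)
  set D := (R + 1) ^ 2 + 2 * R ^ 2 * S ^ 6 with hD
  have hDpos : 0 < D := by positivity
  have hosc : ∀ s ∈ Icc (-(Real.pi / 2)) t, S ^ 6 * R * ‖u s - u t‖ ≤ 1 / 2 := fun s hs => by
    have hss : uIcc s t ⊆ Icc (-(Real.pi / 2)) t := uIcc_subset_Icc hs htt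
    have h1 := h.sol.norm_sub_sq_le (hsub hs) (hsub htt) (A := R + 1) (B := S ^ 6 * R)
      (fun τ hτ => hw τ (hss hτ)) (fun τ hτ => hN τ (hss hτ))
    have h2 : ‖w s - w t‖ ≤ 2 * (R + 1) := (norm_sub_le _ _).trans (by
      linarith [hw s hs, hw t htt])
    have h3 : ‖u s - u t‖ ≤ 2 * R := (norm_sub_le _ _).trans (by
      linarith [h.norm_le (hsub hs), h.norm_le (hsub htt)])
    have h4 : |s - t| ≤ shortTime K R := by
      rw [abs_le]; constructor <;> linarith [hs.1, hs.2, ht.2]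
    have h5 : ‖u s - u t‖ ^ 2 ≤ D * shortTime K R := by
      refine h1.trans ?_
      have : 1 / 2 * ‖w s - w t‖ * (R + 1) + ‖u s - u t‖ * (S ^ 6 * R) ≤ D := by
        calc _ ≤ 1 / 2 * (2 * (R + 1)) * (R + 1) + 2 * R * (S ^ 6 * R) := by gcongr
          _ = D := by rw [hD]; ring
      gcongr
    -- The value of `shortTime` is the one that makes the last product equal to 1/4.
    have h6 : (S ^ 6 * R * ‖u s - u t‖) ^ 2 ≤ (1 / 2) ^ 2 := by
      calc (S ^ 6 * R * ‖u s - u t‖) ^ 2 = S ^ 12 * R ^ 2 * ‖u s - u t‖ ^ 2 := by ring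
        _ ≤ S ^ 12 * R ^ 2 * (D * shortTime K R) := by gcongr
        _ = (1 / 2) ^ 2 := by
          rw [shortTime, ← hS, ← hD]
          field_simp
          norm_num
    exact (sq_le_sq₀ (by positivity) (by norm_num)).1 h6
  have key := h.half_norm_sq_le_of_potential_le ht0 (d := 1 / 2) (by norm_num) fun s hs => by
    have h1 := potential_sub_le hp (hbd t htt) (hbd s hs)
    have h2 : S ^ (4 + 2 * ε) * ‖u s‖ * ‖u s - u t‖ ≤ S ^ 6 * R * ‖u s - u t‖ := by
      gcongr
      exact h.norm_le (hsub hs)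
    linarith [hosc s hs]
  have hw0 : ‖w (-(Real.pi / 2))‖ ≤ R := by
    linarith [h.initial, norm_nonneg (u (-(Real.pi / 2)))]
  have hw0' : ‖w (-(Real.pi / 2))‖ ^ 2 ≤ R ^ 2 := by gcongr
  -- The result is `‖w t‖² ≤ R² + 2`, and `2 < 2 R + 1` because `R ≥ 1`.
  have : ‖w t‖ ^ 2 < (R + 1) ^ 2 := by nlinarith
  exact (sq_lt_sq₀ (norm_nonneg _) (by linarith)).1 this

theorem norm_w_le_short (h : IsCosSol K R ε V u w) :
    ∀ t ∈ Icc (-(Real.pi / 2)) (-(Real.pi / 2) + shortTime K R), ‖w t‖ ≤ R + 1 := by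
  have hδ := shortTime_le_one h.one_le_K h.one_le_R
  have hπ := Real.pi_gt_three
  refine le_of_bootstrap (f := fun t => ‖w t‖)
    (h.sol.contW.norm.mono (Icc_subset_Icc_right (by linarith))) ?_ fun t ht hs => h.norm_w_lt ht hs
  linarith [h.initial, norm_nonneg (u (-(Real.pi / 2)))]

/-- On this half of the interval `(cos t)^ε` does not increase, and the potential is nonnegative
(defocusing sign). -/
theorem energy_antitoneOn (h : IsCosSol K R ε V u w) :
    AntitoneOn (energy ε u w) (Icc 0 (Real.pi / 2)) := by
  have hπ := Real.pi_pos
  have hio : ∀ s ∈ Ioo 0 (Real.pi / 2), s ∈ Ioo (-(Real.pi / 2)) (Real.pi / 2) := fun s hs =>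
    ⟨by linarith [hs.1], hs.2⟩
  refine antitoneOn_of_deriv_nonpos (convex_Icc _ _)
    (h.continuousOn_energy.mono (Icc_subset_Icc_left (by linarith))) ?_ ?_
  · rw [interior_Icc]
    exact fun s hs => (h.hasDerivAt_energy (hio s hs)).differentiableAt.differentiableWithinAt
  · rw [interior_Icc]
    intro s hs
    rw [(h.hasDerivAt_energy (hio s hs)).deriv]
    have h1 : 0 ≤ Real.sin s := Real.sin_nonneg_of_nonneg_of_le_pi hs.1.le (by linarith [hs.2])
    have h2 := h.potential_nonneg (Ioo_subset_Icc_self (hio s hs))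
    have h3 : 0 ≤ Real.cos s ^ (ε - 1) :=
      Real.rpow_nonneg (Real.cos_pos_of_mem_Ioo (hio s hs)).le _
    have := mul_nonneg (mul_nonneg (mul_nonneg h1 h.eps_nonneg) h3) h2
    linarith

/-- Before time `0`, the energy does not grow faster than `(cos t)^ε`. -/
theorem energy_div_antitoneOn (h : IsCosSol K R ε V u w) (hs : -(Real.pi / 2) < s) :
    AntitoneOn (fun t => energy ε u w t / Real.cos t ^ ε) (Icc s 0) := by
  have hπ := Real.pi_pos
  have hi : ∀ t ∈ Icc s 0, t ∈ Ioo (-(Real.pi / 2)) (Real.pi / 2) := fun t ht =>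
    ⟨by linarith [ht.1], by linarith [ht.2]⟩
  have hc : ∀ t ∈ Icc s 0, 0 < Real.cos t := fun t ht => Real.cos_pos_of_mem_Ioo (hi t ht)
  have hd : ∀ t ∈ Ioo s 0, HasDerivAt (fun t => energy ε u w t / Real.cos t ^ ε)
      ((2 * (-Real.sin t * ε * Real.cos t ^ (ε - 1)) * potential (4 + 2 * ε) (u t) *
        Real.cos t ^ ε - energy ε u w t * (-Real.sin t * ε * Real.cos t ^ (ε - 1))) /
          (Real.cos t ^ ε) ^ 2) t := fun t ht => by
    have ht' := Ioo_subset_Icc_self ht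
    exact (h.hasDerivAt_energy (hi t ht')).div (hasDerivAt_cos_rpow (hi t ht'))
      (Real.rpow_pos_of_pos (hc t ht') _).ne'
  refine antitoneOn_of_deriv_nonpos (convex_Icc _ _) ?_ ?_ ?_
  · refine (h.continuousOn_energy.mono fun t ht => Ioo_subset_Icc_self (hi t ht)).div
      h.continuous_cos_rpow.continuousOn fun t ht => (Real.rpow_pos_of_pos (hc t ht) _).ne'
  · rw [interior_Icc]
    exact fun s hs => (hd s hs).differentiableAt.differentiableWithinAt
  · rw [interior_Icc]
    intro t ht
    have ht' := Ioo_subset_Icc_self ht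
    rw [(hd t ht).deriv]
    refine div_nonpos_of_nonpos_of_nonneg ?_ (sq_nonneg _)
    have h1 : Real.sin t ≤ 0 :=
      Real.sin_nonpos_of_nonpos_of_neg_pi_le ht'.2 (by linarith [(hi t ht').1])
    have h2 : 0 ≤ -Real.sin t * ε * Real.cos t ^ (ε - 1) :=
      mul_nonneg (mul_nonneg (by linarith) h.eps_nonneg) (Real.rpow_nonneg (hc t ht').le _)
    have e : energy ε u w t = 1 / 2 * ‖w t‖ ^ 2 +
      2 * Real.cos t ^ ε * potential (4 + 2 * ε) (u t) := rfl
    rw [e]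
    nlinarith [mul_nonneg h2 (sq_nonneg ‖w t‖)]

/-- A bound, depending only on `K` and `R`, for the energy at positive distance from the initial
time. -/
noncomputable def energyBound (K R : ℝ) : ℝ :=
  (1 / 2 * (R + 1) ^ 2 + 2 * (supBound K R ^ 6 * R ^ 2)) / Real.sin (shortTime K R)

/-- The short-time bound controls the energy at `s = -π/2 + δ`. Up to time 0 it then grows at most
by the factor `(cos s)^(-ε)`, which is at most `1 / sin δ` since `ε ≤ 1`; afterwards it does not
grow. -/
theorem energy_le (h : IsCosSol K R ε V u w)
    (ht : t ∈ Icc (-(Real.pi / 2) + shortTime K R) (Real.pi / 2)) :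
    energy ε u w t ≤ energyBound K R := by
  have hK := h.one_le_K
  have hR := h.one_le_R
  have hπ := Real.pi_gt_three
  have hδ1 := shortTime_le_one hK hR
  have hδ := shortTime_pos hK hR
  set δ := shortTime K R with hδd
  set s := -(Real.pi / 2) + δ with hs
  have hsI : s ∈ Icc (-(Real.pi / 2)) (Real.pi / 2) := ⟨by linarith, by linarith⟩
  have hp : 0 ≤ 4 + 2 * ε := by linarith [h.eps_nonneg]
  have hS1 : 1 ≤ supBound K R := one_le_supBound hK hR
  have hws : ‖w s‖ ≤ R + 1 := h.norm_w_le_short s ⟨hsI.1, le_rfl⟩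
  have hP : potential (4 + 2 * ε) (u s) ≤ supBound K R ^ 6 * R ^ 2 := by
    refine (potential_le hp (h.ae_norm_le hsI hws)).trans ?_
    have h1 := h.rpow_le_pow_six hS1
    have h2 := h.norm_le hsI
    unfold supBound at *
    gcongr
  have hEs : energy ε u w s ≤ 1 / 2 * (R + 1) ^ 2 + 2 * (supBound K R ^ 6 * R ^ 2) := by
    have h1 := mul_le_of_le_one_left (h.potential_nonneg hsI) (h.cos_rpow_le_one hsI)
    have h2 : ‖w s‖ ^ 2 ≤ (R + 1) ^ 2 := by gcongr
    have e : energy ε u w s = 1 / 2 * ‖w s‖ ^ 2 +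
      2 * Real.cos s ^ ε * potential (4 + 2 * ε) (u s) := rfl
    rw [e]
    linarith
  have hcs : Real.cos s = Real.sin δ := by
    rw [hs, neg_add_eq_sub, Real.cos_sub_pi_div_two]
  have hsin : 0 < Real.sin δ := Real.sin_pos_of_pos_of_lt_pi hδ (by linarith)
  have hpow : Real.sin δ ≤ Real.cos s ^ ε := by
    rw [hcs]
    calc Real.sin δ = Real.sin δ ^ (1 : ℝ) := (Real.rpow_one _).symm
      _ ≤ Real.sin δ ^ ε := Real.rpow_le_rpow_of_exponent_ge hsin (Real.sin_le_one _) h.eps_le_one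
  have hneg : ∀ r ∈ Icc s 0, energy ε u w r ≤ energyBound K R := by
    intro r hr
    have hrI : r ∈ Icc (-(Real.pi / 2)) (Real.pi / 2) := ⟨by linarith [hr.1], by linarith [hr.2]⟩
    have hrc : 0 < Real.cos r ^ ε := Real.rpow_pos_of_pos
      (Real.cos_pos_of_mem_Ioo ⟨by linarith [hr.1], by linarith [hr.2]⟩) _
    have h1 := h.energy_div_antitoneOn (s := s) (by linarith) (left_mem_Icc.2 (by linarith)) hr hr.1
    simp only at h1
    have h2 : energy ε u w r ≤ energy ε u w r / Real.cos r ^ ε := by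
      rw [le_div_iff₀ hrc]
      refine mul_le_of_le_one_right ?_ (h.cos_rpow_le_one hrI)
      exact le_trans (by positivity) (h.half_norm_sq_le_energy hrI)
    refine h2.trans (h1.trans ?_)
    rw [energyBound]
    gcongr
  rcases le_total t 0 with h0 | h0
  · exact hneg t ⟨ht.1, h0⟩
  · exact (h.energy_antitoneOn (left_mem_Icc.2 (by linarith)) ⟨h0, ht.2⟩ h0).trans
      (hneg 0 ⟨by linarith, le_rfl⟩)

theorem exists_uniform_bound (hK : 1 ≤ K) (hR : 1 ≤ R) : ∃ B : ℝ, 1 ≤ B ∧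
    ∀ (ε : ℝ) (V : Submodule ℂ (L2 × G)) (u : ℝ → L2) (w : ℝ → G), IsCosSol K R ε V u w →
      ∀ t ∈ Icc (-(Real.pi / 2)) (Real.pi / 2), ∀ᵐ x, ‖u t x‖ ≤ B := by
  set M := max (R + 1) (√(2 * energyBound K R)) with hM
  have hMR : R + 1 ≤ M := le_max_left _ _
  refine ⟨K * (R + M), one_le_mul_of_one_le_of_one_le hK (by linarith), fun ε V u w h t ht => ?_⟩
  refine h.ae_norm_le ht ?_
  rcases le_total t (-(Real.pi / 2) + shortTime K R) with h1 | h1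
  · exact (h.norm_w_le_short t ⟨ht.1, h1⟩).trans hMR
  · refine le_trans (Real.le_sqrt_of_sq_le ?_) (le_max_right _ _)
    have := (h.half_norm_sq_le_energy ht).trans (h.energy_le ⟨h1, ht.2⟩)
    linarith

end IsCosSol

end UniformBound

/-! ### Comparison of two solutions and Gronwall's inequality -/

section Difference

/-- This is `1 + x ≤ exp x` at `x = ε log c`. The sign of `ε` is free, and negative exponents are
used below. -/
theorem one_sub_rpow_le {c ε : ℝ} (hc : 0 < c) : 1 - c ^ ε ≤ ε * -Real.log c := by
  rw [Real.rpow_def_of_pos hc]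
  linarith [Real.add_one_le_exp (Real.log c * ε)]

/-- The change of exponent costs `ε |log r|`. For small `r` the factor `r ^ 4` absorbs the
logarithm; for large `r` it is bounded by `B`. -/
theorem abs_one_sub_rpow_mul_le {B r ε : ℝ} (hB : 1 ≤ B) (hr0 : 0 ≤ r) (hrB : r ≤ B)
    (hε0 : 0 ≤ ε) (hε1 : ε ≤ 1) : r ^ 4 * |1 - r ^ (2 * ε)| ≤ 2 * B ^ 7 * ε := by
  rcases hr0.eq_or_lt with rfl | hr
  · simp; positivity
  have hB4 : r ^ 4 ≤ B ^ 4 := by gcongr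
  rcases le_total r 1 with h1 | h1
  · have h2 : r ^ (2 * ε) ≤ 1 := Real.rpow_le_one hr0 h1 (by positivity)
    rw [abs_of_nonneg (by linarith)]
    have h3 := one_sub_rpow_le (ε := 2 * ε) hr
    have h4 : -Real.log r ≤ r⁻¹ - 1 := by
      rw [← Real.log_inv]; exact Real.log_le_sub_one_of_pos (by positivity)
    have h5 : r ^ 4 * -Real.log r ≤ 1 := by
      calc r ^ 4 * -Real.log r ≤ r ^ 4 * r⁻¹ := by gcongr; linarith
        _ = r ^ 3 := by field_simp
        _ ≤ 1 := pow_le_one₀ hr0 h1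
    calc r ^ 4 * (1 - r ^ (2 * ε)) ≤ r ^ 4 * (2 * ε * -Real.log r) := by gcongr
      _ = 2 * ε * (r ^ 4 * -Real.log r) := by ring
      _ ≤ 2 * ε * 1 := by gcongr
      _ ≤ 2 * B ^ 7 * ε := by nlinarith [one_le_pow₀ hB (n := 7)]
  · have h2 : 1 ≤ r ^ (2 * ε) := Real.one_le_rpow h1 (by positivity)
    rw [abs_sub_comm, abs_of_nonneg (by linarith)]
    have hinv : r ^ (2 * ε) - 1 = r ^ (2 * ε) * (1 - r ^ (-(2 * ε))) := by
      rw [mul_sub, ← Real.rpow_add hr]; simp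
    have h3 := one_sub_rpow_le (ε := -(2 * ε)) hr
    have h4 : Real.log r ≤ B := (Real.log_le_self hr0).trans hrB
    have h5 : r ^ (2 * ε) ≤ B ^ 2 := by
      calc r ^ (2 * ε) ≤ r ^ (2 : ℝ) := Real.rpow_le_rpow_of_exponent_le h1 (by linarith)
        _ = r ^ 2 := Real.rpow_two r
        _ ≤ B ^ 2 := by gcongr
    have h6 : 1 - r ^ (-(2 * ε)) ≤ 2 * ε * B := by
      have := mul_le_mul_of_nonneg_left h4 (by linarith : 0 ≤ 2 * ε)
      linarith
    have h7 : 0 ≤ 1 - r ^ (-(2 * ε)) := by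
      have := Real.rpow_le_one_of_one_le_of_nonpos h1 (by linarith : -(2 * ε) ≤ 0)
      linarith
    rw [hinv]
    calc r ^ 4 * (r ^ (2 * ε) * (1 - r ^ (-(2 * ε)))) ≤ B ^ 4 * (B ^ 2 * (2 * ε * B)) := by gcongr
      _ = 2 * B ^ 7 * ε := by ring

theorem norm_nonlin_sub_smul_le {B ε c : ℝ} {z : ℂ} (hB : 1 ≤ B) (hz : ‖z‖ ≤ B) (hε0 : 0 ≤ ε)
    (hε1 : ε ≤ 1) (hc0 : 0 < c) (hc1 : c ≤ 1) :
    ‖nonlin 4 z - ((c ^ ε : ℝ) : ℂ) * nonlin (4 + 2 * ε) z‖ ≤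
      2 * B ^ 7 * (ε * (1 - Real.log c)) * ‖z‖ := by
  have hz0 := norm_nonneg z
  have e : nonlin 4 z - ((c ^ ε : ℝ) : ℂ) * nonlin (4 + 2 * ε) z =
      ((‖z‖ ^ 4 * (1 - c ^ ε) + c ^ ε * (‖z‖ ^ 4 * (1 - ‖z‖ ^ (2 * ε))) : ℝ) : ℂ) * z := by
    have h4 : ‖z‖ ^ (4 : ℝ) = ‖z‖ ^ 4 := by exact_mod_cast Real.rpow_natCast ‖z‖ 4
    rw [nonlin, nonlin, Real.rpow_add_of_nonneg hz0 (by norm_num) (by positivity), h4]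
    push_cast
    ring
  rw [e, norm_mul, Complex.norm_real, Real.norm_eq_abs]
  refine mul_le_mul_of_nonneg_right ?_ hz0
  have hcε0 : 0 ≤ c ^ ε := by positivity
  have hcε1 : c ^ ε ≤ 1 := Real.rpow_le_one hc0.le hc1 hε0
  have h1 := one_sub_rpow_le (ε := ε) hc0
  have h2 := abs_one_sub_rpow_mul_le hB hz0 hz hε0 hε1
  have h3 : ‖z‖ ^ 4 * (1 - c ^ ε) ≤ 2 * B ^ 7 * (ε * -Real.log c) := by
    have hlog : 0 ≤ -Real.log c := by linarith [Real.log_nonpos hc0.le hc1]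
    have h4 : ‖z‖ ^ 4 ≤ 2 * B ^ 7 := by
      calc ‖z‖ ^ 4 ≤ B ^ 4 := by gcongr
        _ ≤ B ^ 7 := pow_le_pow_right₀ hB (by norm_num)
        _ ≤ 2 * B ^ 7 := by linarith [pow_nonneg (zero_le_one.trans hB) 7]
    gcongr
  refine (abs_add_le _ _).trans ?_
  rw [abs_of_nonneg (mul_nonneg (by positivity) (by linarith)), abs_mul, abs_mul,
    abs_of_nonneg hcε0, abs_of_nonneg (by positivity : 0 ≤ ‖z‖ ^ 4)]
  have h5 := mul_le_of_le_one_left (by positivity : 0 ≤ ‖z‖ ^ 4 * |1 - ‖z‖ ^ (2 * ε)|) hcε1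
  linarith

theorem norm_nonlinL2_sub_smul_le {B ε c : ℝ} {f : L2} (hB : 1 ≤ B) (hf : ∀ᵐ x, ‖f x‖ ≤ B)
    (hε0 : 0 ≤ ε) (hε1 : ε ≤ 1) (hc0 : 0 < c) (hc1 : c ≤ 1) :
    ‖nonlinL2 4 f - ((c ^ ε : ℝ) : ℂ) • nonlinL2 (4 + 2 * ε) f‖ ≤
      2 * B ^ 7 * (ε * (1 - Real.log c)) * ‖f‖ := by
  refine Lp.norm_le_mul_norm_of_ae_le_mul ?_
  filter_upwards [hf, coeFn_nonlinL2 (by norm_num : (0 : ℝ) ≤ 4) hf,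
    coeFn_nonlinL2 (by positivity : (0 : ℝ) ≤ 4 + 2 * ε) hf,
    Lp.coeFn_sub (nonlinL2 4 f) (((c ^ ε : ℝ) : ℂ) • nonlinL2 (4 + 2 * ε) f),
    Lp.coeFn_smul ((c ^ ε : ℝ) : ℂ) (nonlinL2 (4 + 2 * ε) f)] with x hx e1 e2 e3 e4
  rw [e3, Pi.sub_apply, e4, Pi.smul_apply, e1, e2, smul_eq_mul]
  exact norm_nonlin_sub_smul_le hB hx hε0 hε1 hc0 hc1

/-- Jordan's inequality gives `cos t ≥ r / 4`, where `r` is the distance to `π/2`. Writing `log (r /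
4) = 2 log (√r / 2)` before applying `log y ≤ y` leaves an integrable singularity `r^(-1/2)` with an
explicit primitive. -/
theorem neg_log_cos_le_of_nonneg {t : ℝ} (h0 : 0 ≤ t) (h1 : t < Real.pi / 2) :
    -Real.log (Real.cos t) ≤ 4 / √(Real.pi / 2 - t) := by
  set r := Real.pi / 2 - t with hr
  have hr0 : 0 < r := by linarith
  have hπ := Real.pi_pos
  have hcos : r / 4 ≤ Real.cos t := by
    have h2 := Real.one_sub_mul_le_cos h0 h1.le
    have h3 : 1 - 2 / Real.pi * t = 2 / Real.pi * r := by rw [hr]; field_simp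
    have h4 : 1 / 4 ≤ 2 / Real.pi := by
      rw [div_le_div_iff₀ (by norm_num) hπ]; linarith [Real.pi_lt_four]
    have := mul_le_mul_of_nonneg_right h4 hr0.le
    linarith
  have hs : 0 < √r := Real.sqrt_pos.2 hr0
  have h5 : Real.log (r / 4) = 2 * Real.log (√r / 2) := by
    rw [← Real.log_rpow (by positivity) 2, Real.rpow_two, div_pow, Real.sq_sqrt hr0.le]
    norm_num
  have h6 : Real.log (r / 4) ≤ Real.log (Real.cos t) := Real.log_le_log (by positivity) hcos
  have h7 : -Real.log (√r / 2) ≤ 2 / √r := by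
    rw [← Real.log_inv, inv_div]
    exact Real.log_le_self (by positivity)
  have h8 : 4 / √r = 2 * (2 / √r) := by ring
  linarith

theorem neg_log_cos_le {t : ℝ} (ht : t ∈ Ioo (-(Real.pi / 2)) (Real.pi / 2)) :
    -Real.log (Real.cos t) ≤ 4 / √(Real.pi / 2 + t) + 4 / √(Real.pi / 2 - t) := by
  rcases le_total 0 t with h | h
  · have := neg_log_cos_le_of_nonneg h ht.2
    have h2 : 0 ≤ 4 / √(Real.pi / 2 + t) := by positivity
    linarith
  · have := neg_log_cos_le_of_nonneg (t := -t) (by linarith) (by linarith [ht.1])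
    rw [Real.cos_neg, sub_neg_eq_add] at this
    have h2 : 0 ≤ 4 / √(Real.pi / 2 - t) := by positivity
    linarith

/-- An increasing primitive of a majorant of `3 - log (cos t)`. -/
noncomputable def growth (t : ℝ) : ℝ := 3 * t + 8 * √(Real.pi / 2 + t) - 8 * √(Real.pi / 2 - t)

theorem continuous_growth : Continuous growth := by
  unfold growth
  fun_prop

theorem hasDerivAt_growth {t : ℝ} (ht : t ∈ Ioo (-(Real.pi / 2)) (Real.pi / 2)) :
    HasDerivAt growth (3 + 4 / √(Real.pi / 2 + t) + 4 / √(Real.pi / 2 - t)) t := by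
  have h1 : Real.pi / 2 + t ≠ 0 := by linarith [ht.1]
  have h2 : Real.pi / 2 - t ≠ 0 := by linarith [ht.2]
  have d1 := ((hasDerivAt_id t).const_add (Real.pi / 2)).sqrt h1
  have d2 := ((hasDerivAt_id t).const_sub (Real.pi / 2)).sqrt h2
  have d := (((hasDerivAt_id t).const_mul 3).add (d1.const_mul 8)).sub (d2.const_mul 8)
  refine d.congr_deriv ?_
  simp only [id]
  ring

theorem growth_mono {s t : ℝ} (h : s ≤ t) : growth s ≤ growth t := by
  unfold growth
  gcongr

/-- Gronwall's inequality with the majorant `3 - log (cos t)`, integrable but unbounded. -/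
theorem le_exp_growth_mul {Z Z' : ℝ → ℝ} {C : ℝ} (hC : 0 ≤ C)
    (hZ : ContinuousOn Z (Icc (-(Real.pi / 2)) (Real.pi / 2)))
    (hd : ∀ t ∈ Ioo (-(Real.pi / 2)) (Real.pi / 2), HasDerivAt Z (Z' t) t)
    (hZ0 : ∀ t, 0 ≤ Z t)
    (hle : ∀ t ∈ Ioo (-(Real.pi / 2)) (Real.pi / 2),
      Z' t ≤ C * (3 - Real.log (Real.cos t)) * Z t)
    {t : ℝ} (ht : t ∈ Icc (-(Real.pi / 2)) (Real.pi / 2)) :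
    Z t ≤ Real.exp (C * (growth (Real.pi / 2) - growth (-(Real.pi / 2)))) *
      Z (-(Real.pi / 2)) := by
  have hπ := Real.pi_pos
  have hdd : ∀ t ∈ Ioo (-(Real.pi / 2)) (Real.pi / 2),
      HasDerivAt (fun t => Z t * Real.exp (-(C * growth t)))
        (Z' t * Real.exp (-(C * growth t)) + Z t * (Real.exp (-(C * growth t)) *
          (-(C * (3 + 4 / √(Real.pi / 2 + t) + 4 / √(Real.pi / 2 - t)))))) t := fun t ht =>
    (hd t ht).mul (((hasDerivAt_growth ht).const_mul C).neg.exp)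
  have hanti : AntitoneOn (fun t => Z t * Real.exp (-(C * growth t)))
      (Icc (-(Real.pi / 2)) (Real.pi / 2)) := by
    refine antitoneOn_of_deriv_nonpos (convex_Icc _ _) (hZ.mul
      (Real.continuous_exp.comp (continuous_const.mul continuous_growth).neg).continuousOn) ?_ ?_
    · rw [interior_Icc]
      exact fun s hs => (hdd s hs).differentiableAt.differentiableWithinAt
    · rw [interior_Icc]
      intro s hs
      rw [(hdd s hs).deriv]
      have h1 : Z' s ≤ C * (3 + 4 / √(Real.pi / 2 + s) + 4 / √(Real.pi / 2 - s)) * Z s := by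
        refine (hle s hs).trans ?_
        have := hZ0 s
        gcongr
        linarith [neg_log_cos_le hs]
      have h2 := mul_le_mul_of_nonneg_right h1 (Real.exp_pos (-(C * growth s))).le
      linarith
  have h := hanti (left_mem_Icc.2 (by linarith)) ht ht.1
  simp only at h
  have h1 : Z t ≤ Z (-(Real.pi / 2)) * Real.exp (C * (growth t - growth (-(Real.pi / 2)))) := by
    calc Z t = Z t * Real.exp (-(C * growth t)) * Real.exp (C * growth t) := by
          rw [mul_assoc, ← Real.exp_add]; simp
      _ ≤ Z (-(Real.pi / 2)) * Real.exp (-(C * growth (-(Real.pi / 2)))) *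
          Real.exp (C * growth t) := by gcongr
      _ = _ := by rw [mul_assoc, ← Real.exp_add]; ring_nf
  refine h1.trans ?_
  rw [mul_comm]
  have := hZ0 (-(Real.pi / 2))
  have := growth_mono ht.2
  gcongr

variable {G : Type*} [NormedAddCommGroup G] [InnerProductSpace ℂ G]

theorem IsCosSol.norm_sub_le {K R ε B : ℝ} {V : Submodule ℂ (L2 × G)} {u u' : ℝ → L2}
    {w w' : ℝ → G} (h : IsCosSol K R 0 V u w) (h' : IsCosSol K R ε V u' w') (hB1 : 1 ≤ B)
    (hB : ∀ t ∈ Icc (-(Real.pi / 2)) (Real.pi / 2), ∀ᵐ x, ‖u t x‖ ≤ B)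
    (hB' : ∀ t ∈ Icc (-(Real.pi / 2)) (Real.pi / 2), ∀ᵐ x, ‖u' t x‖ ≤ B)
    {t : ℝ} (ht : t ∈ Icc (-(Real.pi / 2)) (Real.pi / 2)) :
    ‖u t - u' t‖ ≤ Real.exp ((5 * B ^ 4 + 2 * B ^ 7 * R) *
      (growth (Real.pi / 2) - growth (-(Real.pi / 2)))) *
        (‖u (-(Real.pi / 2)) - u' (-(Real.pi / 2))‖ + ε) := by
  have hR := h.one_le_R
  have hε0 := h'.eps_nonneg
  have hε1 := h'.eps_le_one
  have hπ := Real.pi_pos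
  have hsol := h.sol.sub h'.sol
  set C := 5 * B ^ 4 + 2 * B ^ 7 * R with hC
  have hCpos : 0 ≤ C := by positivity
  set T := growth (Real.pi / 2) - growth (-(Real.pi / 2)) with hT
  have hT0 : 0 ≤ T := sub_nonneg.2 (growth_mono (by linarith))
  -- Insert the limit nonlinearity at `u' s`: the Lipschitz constant `5 B ^ 4` handles `u - u'`, and
  -- the mismatch of coefficient and exponent, with the mass bound `R`, gives the term `2 B ^ 7 R`.
  have hN : ∀ s ∈ Ioo (-(Real.pi / 2)) (Real.pi / 2),
      ‖((Real.cos s ^ (0 : ℝ) : ℝ) : ℂ) • nonlinL2 (4 + 2 * 0) (u s) -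
        ((Real.cos s ^ ε : ℝ) : ℂ) • nonlinL2 (4 + 2 * ε) (u' s)‖ ≤
      C * (‖u s - u' s‖ + ε * (1 - Real.log (Real.cos s))) := by
    intro s hs
    have hs' := Ioo_subset_Icc_self hs
    have hc := Real.cos_pos_of_mem_Ioo hs
    have hlog := Real.log_nonpos hc.le (Real.cos_le_one s)
    rw [Real.rpow_zero, Complex.ofReal_one, one_smul, mul_zero, add_zero]
    have h1 := norm_nonlinL2_sub_le (by norm_num : (1 : ℝ) < 4) (hB s hs') (hB' s hs')
    have h2 := norm_nonlinL2_sub_smul_le hB1 (hB' s hs') hε0 hε1 hc (Real.cos_le_one s)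
    have h3 := h'.norm_le hs'
    have h4 : B ^ (4 : ℝ) = B ^ 4 := by exact_mod_cast Real.rpow_natCast B 4
    rw [h4] at h1
    have h5 : 0 ≤ ε * (1 - Real.log (Real.cos s)) := mul_nonneg hε0 (by linarith)
    have h6 := mul_le_mul_of_nonneg_left h3
      (by positivity : 0 ≤ 2 * B ^ 7 * (ε * (1 - Real.log (Real.cos s))))
    have h7 := norm_sub_le_norm_sub_add_norm_sub (nonlinL2 4 (u s)) (nonlinL2 4 (u' s))
      (((Real.cos s ^ ε : ℝ) : ℂ) • nonlinL2 (4 + 2 * ε) (u' s))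
    have h8 : 0 ≤ 5 * B ^ 4 * (ε * (1 - Real.log (Real.cos s))) := by positivity
    have h9 : 0 ≤ 2 * B ^ 7 * R * ‖u s - u' s‖ := by positivity
    rw [hC]
    linarith
  -- Adding `ε²` to the squared distance makes the differential inequality homogeneous. With `y` the
  -- distance, the source term is absorbed by `2 y ε ≤ y² + ε²`; the factor `3 - log cos` is `2`
  -- from the Lipschitz part plus `1 - log cos` from the source.
  have hZ : ∀ s ∈ Icc (-(Real.pi / 2)) (Real.pi / 2), ‖u s - u' s‖ ^ 2 + ε ^ 2 ≤
      Real.exp (C * T) * (‖u (-(Real.pi / 2)) - u' (-(Real.pi / 2))‖ ^ 2 + ε ^ 2) := by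
    intro s hs
    refine le_exp_growth_mul (Z := fun s => ‖u s - u' s‖ ^ 2 + ε ^ 2) hCpos
      ((hsol.contU.norm.pow 2).add continuousOn_const)
      (fun r hr => ((hsol.hasDerivWithinAt_norm_sq (convex_Icc _ _)
        (Ioo_subset_Icc_self hr)).hasDerivAt (Icc_mem_nhds hr.1 hr.2)).add_const _)
      (fun r => by positivity) (fun r hr => ?_) hs
    have h1 : (inner ℂ (u r - u' r) (((Real.cos r ^ (0 : ℝ) : ℝ) : ℂ) • nonlinL2 (4 + 2 * 0) (u r) -
        ((Real.cos r ^ ε : ℝ) : ℂ) • nonlinL2 (4 + 2 * ε) (u' r))).im ≤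
        ‖u r - u' r‖ * (C * (‖u r - u' r‖ + ε * (1 - Real.log (Real.cos r)))) :=
      (Complex.im_le_norm _).trans ((norm_inner_le_norm _ _).trans
        (mul_le_mul_of_nonneg_left (hN r hr) (norm_nonneg _)))
    have hlog := Real.log_nonpos (Real.cos_pos_of_mem_Ioo hr).le (Real.cos_le_one r)
    have h2 : 0 ≤ C * (1 - Real.log (Real.cos r)) := mul_nonneg hCpos (by linarith)
    have h3 := mul_nonneg h2 (sq_nonneg (‖u r - u' r‖ - ε))
    have h4 : 0 ≤ 2 * C * ε ^ 2 := by positivity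
    linarith
  have h1 := hZ t ht
  have hE : 1 ≤ Real.exp (C * T) := Real.one_le_exp (mul_nonneg hCpos hT0)
  refine (sq_le_sq₀ (norm_nonneg _) (by positivity)).1 ?_
  set y := ‖u (-(Real.pi / 2)) - u' (-(Real.pi / 2))‖ with hy
  have hy0 : 0 ≤ y := norm_nonneg _
  calc ‖u t - u' t‖ ^ 2 ≤ Real.exp (C * T) * (y ^ 2 + ε ^ 2) := by linarith [sq_nonneg ε]
    _ ≤ Real.exp (C * T) ^ 2 * (y + ε) ^ 2 := by
        gcongr
        · exact le_self_pow₀ hE (by norm_num)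
        · nlinarith [mul_nonneg hy0 hε0]
    _ = (Real.exp (C * T) * (y + ε)) ^ 2 := by ring

theorem IsSolution.isCosSol {K R ε : ℝ} {v₀ : ℝ → ℂ} {v : ℝ → ℝ → ℂ} (hK : 1 ≤ K)
    (hSob : ∀ f : ℝ → ℂ, MemSigma f → ∀ᵐ x, ‖toL2 f x‖ ≤ K * (‖toL2 f‖ + ‖toGrad f‖))
    (hR : 1 ≤ R) (hε0 : 0 ≤ ε) (hε1 : ε ≤ 1) (hv₀ : sigmaNorm v₀ ≤ ENNReal.ofReal R)
    (h : IsSolution (fun t => Real.cos t ^ ε) (4 + 2 * ε) v₀ v) :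
    IsCosSol K R ε sigmaGraph (fun t => toL2 (v t)) (fun t => toGrad (v t)) where
  sol := h.isWeakSol (by linarith) (Real.continuous_cos.rpow_const fun _ => Or.inr hε0)
  sobolev t ht := hSob _ (h.memSigma t ht)
  initial := by
    have hm := h.memSigma _ IsCosSol.left_mem
    refine hm.norm_toL2_add_le.trans ?_
    rw [sigmaNorm_congr hm h.initial]
    exact ENNReal.toReal_le_of_le_ofReal (by linarith) hv₀
  one_le_K := hK
  one_le_R := hR
  eps_nonneg := hε0
  eps_le_one := hε1

end Difference

end HarmonicNLS

/-! ### The stability estimate -/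

theorem propositionC1 (R : ℝ≥0) :
    ∃ C : ℝ≥0, ∀ ε : ℝ, 0 < ε → ε < 1 →
      ∀ v₀ v₀ε : ℝ → ℂ,
        HarmonicNLS.MemSigma v₀ → HarmonicNLS.sigmaNorm v₀ ≤ R →
        HarmonicNLS.MemSigma v₀ε → HarmonicNLS.sigmaNorm v₀ε ≤ R →
        ∀ v vε : ℝ → ℝ → ℂ,
          HarmonicNLS.IsSolution (fun _ => 1) 4 v₀ v →
          HarmonicNLS.IsSolution (fun t => Real.cos t ^ ε) (4 + 2 * ε) v₀ε vε →
          (⨆ t ∈ Icc (-(Real.pi / 2)) (Real.pi / 2),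
              eLpNorm (fun x => v t x - vε t x) 2 volume) ≤
            C * eLpNorm (fun x => v₀ x - v₀ε x) 2 volume + C * ENNReal.ofReal ε := by
  obtain ⟨K, hK, hSob⟩ := HarmonicNLS.exists_norm_le_sigma
  -- Passing to `K + 1` and `R + 1` ensures that both constants are at least 1.
  obtain ⟨B, hB1, hB⟩ := HarmonicNLS.IsCosSol.exists_uniform_bound
    (G := WithLp 2 (HarmonicNLS.L2 × HarmonicNLS.L2)) (K := K + 1) (R := R + 1)
    (by linarith) (by simp)
  set C₀ : ℝ := Real.exp ((5 * B ^ 4 + 2 * B ^ 7 * (R + 1)) *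
    (HarmonicNLS.growth (Real.pi / 2) - HarmonicNLS.growth (-(Real.pi / 2)))) with hC₀
  have hC₀0 : 0 ≤ C₀ := (Real.exp_pos _).le
  refine ⟨C₀.toNNReal, fun ε hε0 hε1 v₀ v₀ε _ hn _ hnε v vε hv hvε => ?_⟩
  have hSob' : ∀ f : ℝ → ℂ, HarmonicNLS.MemSigma f → ∀ᵐ x, ‖HarmonicNLS.toL2 f x‖ ≤
      (K + 1) * (‖HarmonicNLS.toL2 f‖ + ‖HarmonicNLS.toGrad f‖) := fun f hf => by
    filter_upwards [hSob f hf] with x hx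
    exact hx.trans (by gcongr; linarith)
  have hR : (R : ℝ≥0∞) ≤ ENNReal.ofReal (R + 1) := by
    rw [← ENNReal.ofReal_coe_nnreal]
    exact ENNReal.ofReal_le_ofReal (by linarith)
  -- The limit equation is the member `ε = 0` of the family; the convention `0 ^ 0 = 1` keeps its
  -- coefficient equal to 1 at the endpoints too.
  have hv' : HarmonicNLS.IsSolution (fun t => Real.cos t ^ (0 : ℝ)) (4 + 2 * 0) v₀ v := by
    simpa only [Real.rpow_zero, mul_zero, add_zero] using hv
  have hs := hv'.isCosSol (by linarith : 1 ≤ K + 1) hSob' (by simp : (1 : ℝ) ≤ R + 1) le_rfl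
    zero_le_one (hn.trans hR)
  have hsε := hvε.isCosSol (by linarith : 1 ≤ K + 1) hSob' (by simp : (1 : ℝ) ≤ R + 1) hε0.le
    hε1.le (hnε.trans hR)
  have hnorm : ∀ t ∈ Icc (-(Real.pi / 2)) (Real.pi / 2),
      eLpNorm (fun x => v t x - vε t x) 2 volume =
        ENNReal.ofReal ‖HarmonicNLS.toL2 (v t) - HarmonicNLS.toL2 (vε t)‖ := fun t ht => by
    have m1 := (hv.memSigma t ht).1
    have m2 := (hvε.memSigma t ht).1
    rw [← HarmonicNLS.toL2_sub m1 m2, ofReal_norm]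
    exact (HarmonicNLS.enorm_toL2 (m1.sub m2)).symm
  have hinit : eLpNorm (fun x => v₀ x - v₀ε x) 2 volume =
      eLpNorm (fun x => v (-(Real.pi / 2)) x - vε (-(Real.pi / 2)) x) 2 volume :=
    eLpNorm_congr_ae (hv.initial.sub hvε.initial).symm
  rw [hinit, hnorm _ HarmonicNLS.IsCosSol.left_mem]
  refine iSup₂_le fun t ht => ?_
  rw [hnorm t ht, ← mul_add, ← ENNReal.ofReal_add (norm_nonneg _) hε0.le]
  change _ ≤ ENNReal.ofReal C₀ * _
  rw [← ENNReal.ofReal_mul hC₀0]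
  exact ENNReal.ofReal_le_ofReal (hs.norm_sub_le hsε hB1 (hB _ _ _ _ hs) (hB _ _ _ _ hsε) ht)
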